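/- For integers $k \ge 2$ and $n \ge 1$ with $k \mid n$, the unbiased Waiter–Client $K_k$-factor game on $K_n$ is played as follows. All edges of $K_n$ are initially unclaimed. In each round Waiter offers two unclaimed edges; Client adds one of them, of his choice, to Client's graph, and the other is added to Waiter's graph. Waiter wins as soon as Client's graph contains a $K_k$-factor, that is, the edges of vertex-disjoint copies of $K_k$ covering all $n$ vertices. If Waiter has a winning strategy, let $\tau_{WC}(\mathcal{F}_{n,K_k\text{-fac}},1)$ denote the number of rounds the game lasts when Waiter tries to win as fast as possible, Client tries to delay her as long as possible, and both play optimally. Theorem. There are functions $n_0(k)$ and $C(k)$ of $k$ alone, and a function $f(k)$ of $k$ alone with $f(k)=o(k)$ as $k\to\infty$, such that for every $k \ge 2$ and every $n \ge n_0(k)$ divisible by $k$, Waiter has a winning strategy and $$2^{k/3-f(k)}\,n \;\le\; \tau_{WC}(\mathcal{F}_{n,K_k\text{-fac}},1) \;\le\; 2^k\,\frac{n}{k} + C(k).$$ Moreover, one can take $f(k)=k/\log k$ for all $k \ge 10^8$ (with $\log$ the natural logarithm), and $C(k)=2^{8^k}+2^k k$ for all $k \ge 4$. -/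

import Mathlib

open scoped Asymptotics

namespace WaiterClient

variable {α : Type*} [DecidableEq α]

/-- `ForcesWithin X b 𝓕 t C W`: in the Waiter-Client game with board `X`, bias `b` and family of
winning sets `𝓕`, from the position in which Client owns `C`, Waiter owns `W` and the rest of `X`
is unclaimed, Waiter (who moves by offering `b + 1` unclaimed elements, of which Client keeps one
of his choice and Waiter gets the others) can force Client's set to contain a winning set within
at most `t` further rounds. -/
def ForcesWithin (X : Finset α) (b : ℕ) (𝓕 : Set (Finset α)) :
    ℕ → Finset α → Finset α → Prop
  | 0, C, _ => ∃ F ∈ 𝓕, F ⊆ C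
  | t + 1, C, W =>
      (∃ F ∈ 𝓕, F ⊆ C) ∨
        ∃ O : Finset α, O ⊆ X \ (C ∪ W) ∧ O.card = b + 1 ∧
          ∀ e ∈ O, ForcesWithin X b 𝓕 t (insert e C) (W ∪ O.erase e)

/-- Waiter wins the game played from the initial position, where everything is unclaimed. -/
def WaiterWins (X : Finset α) (b : ℕ) (𝓕 : Set (Finset α)) : Prop :=
  ∃ t : ℕ, ForcesWithin X b 𝓕 t ∅ ∅

/-- The number of rounds that the game lasts under optimal play, that is, the least number of
rounds within which Waiter can force a win. It is meaningful only if `WaiterWins X b 𝓕`. -/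
noncomputable def tau (X : Finset α) (b : ℕ) (𝓕 : Set (Finset α)) : ℕ :=
  sInf {t : ℕ | ForcesWithin X b 𝓕 t ∅ ∅}

/-- The board `E(K_n)`. -/
def board (n : ℕ) : Finset (Sym2 (Fin n)) :=
  (⊤ : SimpleGraph (Fin n)).edgeFinset

/-- The edge sets of the `K_k`-factors of `K_n`: the vertices are partitioned into sets of size
`k`, and the edges are exactly those joining two vertices of the same part. -/
def cliqueFactors (n k : ℕ) : Set (Finset (Sym2 (Fin n))) :=
  {E | ∃ P : Finpartition (Finset.univ : Finset (Fin n)),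
    (∀ p ∈ P.parts, p.card = k) ∧
      ∀ e, e ∈ E ↔ e ∈ board n ∧ ∃ p ∈ P.parts, ∀ v ∈ e, v ∈ p}

end WaiterClient

/-!
# The unbiased Waiter-Client clique-factor game

*Upper bound.* In a set of `2 ^ k - 1` vertices without claimed edges, Waiter offers the edges at
one vertex `v` in pairs, so that `v` gets `2 ^ (k - 1) - 1` neighbours in Client's graph, and goes
on inside this neighbourhood. After at most `2 ^ k` rounds Client has a `k`-clique, and every edge
claimed on the way meets it, so all other vertices are as fresh as before (`reach_clique`). Hence
the strategy can be repeated until a set `L` of boundedly many vertices is left. To absorb `L`,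
Waiter has prepared many reserve cliques `Q` whose mutual edges are unclaimed. Halving the index
set again and again, she joins all of `L` to `Q \ {u}` for many of them, `u` being a fixed vertex
of `Q`, then builds `|L| / k` cliques among the vertices `u` and puts the vertices of `L` in their
places (`tiles_univ_of_swap`, `reach_tiling`). Only the halving costs more than `2 ^ k` rounds per
clique, and its cost is bounded in terms of `k`.

*Lower bound.* Let `d = 2 ^ (k / 3 - k / log k)` and let `k` be large. If the game ends within
`t < d * n` rounds, then in at least half of the `n / k` cliques of the factor all vertices meet at
most `D = 8 * d * k` claimed edges. Client prevents this with a potential that bounds the expected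
number of such cliques if he played at random from now on. A vertex set `A` that is connected in
Client's graph and contains no edge of Waiter survives with probability `2 ^ (-m)`, where `m` is the
number of its free edges. When an edge joins connected sets of sizes `b ≤ a`, the other `a * b - 1`
edges between them are still free; the larger set is charged for the new one, the smaller one being
one of at most `(k * D) ^ (b - 1)` connected sets at an endpoint of the edge (`card_conn_le`), and
the degree bound limits how often a set is charged. The cheapest way to grow is to join sets of
equal size, which gives the recursion `sum_growthWeight_le`, with about `k ^ 2 / 3` edges taken at
random in a clique; its solution is less than `1 / (2 * k)` per vertex as `D` is well below
`2 ^ (k / 3)`. For smaller `k` the choice of `f` makes the bound `n / 2`, which holds since every vertex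
needs an edge.
-/

namespace WaiterClient

/-! ### Forcing a property of the position -/

section Reach

variable {α : Type*} [DecidableEq α]

/-- In the unbiased game on `X`, Waiter can force, from the position `(C, W)` and within `t`
rounds, a position satisfying `P`. This extends `ForcesWithin` from winning sets to arbitrary
properties of the position, so that strategies can be run one after the other. -/
def Reach (X : Finset α) (P : Finset α → Finset α → Prop) :
    ℕ → Finset α → Finset α → Prop
  | 0, C, W => P C W
  | t + 1, C, W => P C W ∨ ∃ e f, e ≠ f ∧ e ∈ X \ (C ∪ W) ∧ f ∈ X \ (C ∪ W) ∧
      Reach X P t (insert e C) (insert f W) ∧ Reach X P t (insert f C) (insert e W)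

theorem Reach.of_now {X : Finset α} {P : Finset α → Finset α → Prop} {t : ℕ} {C W : Finset α}
    (h : P C W) : Reach X P t C W := by
  cases t with
  | zero => exact h
  | succ t => exact Or.inl h

theorem Reach.mono {X : Finset α} {P Q : Finset α → Finset α → Prop}
    (hPQ : ∀ C W, P C W → Q C W) :
    ∀ {t : ℕ} {C W : Finset α}, Reach X P t C W → Reach X Q t C W
  | 0, _, _, h => hPQ _ _ h
  | _ + 1, _, _, Or.inl h => Or.inl (hPQ _ _ h)
  | _ + 1, _, _, Or.inr ⟨e, f, hef, he, hf, h₁, h₂⟩ =>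
      Or.inr ⟨e, f, hef, he, hf, h₁.mono hPQ, h₂.mono hPQ⟩

theorem Reach.succ {X : Finset α} {P : Finset α → Finset α → Prop} :
    ∀ {t : ℕ} {C W : Finset α}, Reach X P t C W → Reach X P (t + 1) C W
  | 0, _, _, h => Or.inl h
  | _ + 1, _, _, Or.inl h => Or.inl h
  | _ + 1, _, _, Or.inr ⟨e, f, hef, he, hf, h₁, h₂⟩ =>
      Or.inr ⟨e, f, hef, he, hf, h₁.succ, h₂.succ⟩

theorem Reach.mono_time {X : Finset α} {P : Finset α → Finset α → Prop} {s t : ℕ} (hst : s ≤ t)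
    {C W : Finset α} (h : Reach X P s C W) : Reach X P t C W := by
  induction hst with
  | refl => exact h
  | step _ ih => exact ih.succ

theorem Reach.bind {X : Finset α} {P Q : Finset α → Finset α → Prop} {t : ℕ}
    (hPQ : ∀ C W, P C W → Reach X Q t C W) :
    ∀ {s : ℕ} {C W : Finset α}, Reach X P s C W → Reach X Q (s + t) C W
  | 0, _, _, h => (hPQ _ _ h).mono_time (Nat.le_add_left _ _)
  | _ + 1, _, _, Or.inl h => (hPQ _ _ h).mono_time (Nat.le_add_left _ _)
  | s + 1, C, W, Or.inr ⟨e, f, hef, he, hf, h₁, h₂⟩ => by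
      rw [Nat.succ_add]
      exact Or.inr ⟨e, f, hef, he, hf, h₁.bind hPQ, h₂.bind hPQ⟩

theorem Reach.forcesWithin {X : Finset α} {𝓕 : Set (Finset α)} :
    ∀ {t : ℕ} {C W : Finset α}, Reach X (fun C _ => ∃ F ∈ 𝓕, F ⊆ C) t C W →
      ForcesWithin X 1 𝓕 t C W
  | 0, _, _, h => h
  | _ + 1, _, _, Or.inl h => Or.inl h
  | t + 1, C, W, Or.inr ⟨e, f, hef, he, hf, h₁, h₂⟩ => by
      refine Or.inr ⟨{e, f}, ?_, Finset.card_pair hef, ?_⟩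
      · intro x hx
        rcases Finset.mem_insert.1 hx with rfl | hx
        · exact he
        · rwa [Finset.mem_singleton.1 hx]
      · intro x hx
        have key : ∀ a b : α, a ≠ b → W ∪ ({a, b} : Finset α).erase a = insert b W := by
          intro a b hab
          ext z
          simp only [Finset.mem_union, Finset.mem_erase, Finset.mem_insert, Finset.mem_singleton]
          grind
        rcases Finset.mem_insert.1 hx with rfl | hx
        · rw [key _ _ hef]
          exact h₁.forcesWithin
        · rw [Finset.mem_singleton.1 hx, Finset.pair_comm, key _ _ hef.symm]
          exact h₂.forcesWithin

/-- The position `(C', W')` is a continuation of `(C, W)` in which Client lost nothing and all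
newly claimed elements lie in `E`. -/
def Within (E : Set α) (C W C' W' : Finset α) : Prop :=
  C ⊆ C' ∧ ∀ e ∈ C' ∪ W', e ∈ C ∪ W ∨ e ∈ E

theorem Within.refl (E : Set α) (C W : Finset α) : Within E C W C W :=
  ⟨subset_rfl, fun _ h => Or.inl h⟩

theorem Within.trans {E₁ E₂ E : Set α} {C W C' W' C'' W'' : Finset α}
    (h₁ : Within E₁ C W C' W') (h₂ : Within E₂ C' W' C'' W'') (hE₁ : E₁ ⊆ E) (hE₂ : E₂ ⊆ E) :
    Within E C W C'' W'' := by
  refine ⟨h₁.1.trans h₂.1, fun e he => ?_⟩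
  rcases h₂.2 e he with h | h
  · rcases h₁.2 e h with h | h
    · exact Or.inl h
    · exact Or.inr (hE₁ h)
  · exact Or.inr (hE₂ h)

theorem Within.notMem {E : Set α} {C W C' W' : Finset α} (h : Within E C W C' W') {e : α}
    (he : e ∉ C ∪ W) (he' : e ∉ E) : e ∉ C' ∪ W' :=
  fun hm => (h.2 e hm).elim he he'

/-- Offering the unclaimed elements `φ i` two at a time, Waiter makes Client own half of them. -/
theorem reach_half {ι : Type*} [DecidableEq ι] {X : Finset α} (φ : ι → α) (m : ℕ) :
    ∀ (I : Finset ι) (C W : Finset α), 2 * m ≤ I.card → Set.InjOn φ I → (∀ i ∈ I, φ i ∈ X) →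
      (∀ i ∈ I, φ i ∉ C ∪ W) →
      Reach X (fun C' W' => ∃ J ⊆ I, J.card = m ∧ (∀ j ∈ J, φ j ∈ C') ∧
        Within (φ '' I) C W C' W') m C W := by
  induction m with
  | zero =>
      intro I C W _ _ _ _
      exact ⟨∅, by simp, rfl, by simp, Within.refl _ _ _⟩
  | succ m ih =>
      intro I C W hI hφ hX hfree
      obtain ⟨i, hi, j, hj, hij⟩ := Finset.one_lt_card.1 (show 1 < I.card by omega)
      have hne : φ i ≠ φ j := fun h => hij (hφ hi hj h)
      -- One offer of the pair `φ a, φ b`, of which Client keeps `φ a`.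
      have step : ∀ a b, a ∈ I → b ∈ I → a ≠ b →
          Reach X (fun C' W' => ∃ J ⊆ I, J.card = m + 1 ∧ (∀ j ∈ J, φ j ∈ C') ∧
            Within (φ '' I) C W C' W') m (insert (φ a) C) (insert (φ b) W) := by
        intro a b ha hb hab
        have hsub : (I.erase a).erase b ⊆ I :=
          (Finset.erase_subset _ _).trans (Finset.erase_subset _ _)
        have hcard : ((I.erase a).erase b).card = I.card - 2 := by
          rw [Finset.card_erase_of_mem (Finset.mem_erase.2 ⟨hab.symm, hb⟩),
            Finset.card_erase_of_mem ha]
          omega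
        refine (ih ((I.erase a).erase b) _ _ (by omega) (hφ.mono (by exact_mod_cast hsub))
          (fun i hi => hX i (hsub hi)) ?_).mono ?_
        · intro i hi hmem
          have hi' := Finset.mem_erase.1 hi
          have hi'' := Finset.mem_erase.1 hi'.2
          have := hfree i hi''.2
          simp only [Finset.mem_union, Finset.mem_insert] at hmem this
          rcases hmem with (h | h) | (h | h)
          · exact hi''.1 (hφ hi''.2 ha h)
          · exact this (Or.inl h)
          · exact hi'.1 (hφ hi''.2 hb h)
          · exact this (Or.inr h)
        · rintro C' W' ⟨J, hJ, hJc, hJC, hW⟩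
          have haJ : a ∉ J := fun h => by simpa using hJ h
          refine ⟨insert a J, ?_, by rw [Finset.card_insert_of_notMem haJ, hJc], ?_, ?_, ?_⟩
          · exact Finset.insert_subset ha (hJ.trans hsub)
          · intro x hx
            rcases Finset.mem_insert.1 hx with rfl | hx
            · exact hW.1 (Finset.mem_insert_self _ _)
            · exact hJC x hx
          · exact (Finset.subset_insert _ _).trans hW.1
          · intro e he
            rcases hW.2 e he with h | ⟨x, hx, rfl⟩
            · simp only [Finset.mem_union, Finset.mem_insert] at h ⊢
              rcases h with (rfl | h) | (rfl | h)
              · exact Or.inr ⟨a, ha, rfl⟩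
              · exact Or.inl (Or.inl h)
              · exact Or.inr ⟨b, hb, rfl⟩
              · exact Or.inl (Or.inr h)
            · exact Or.inr ⟨x, hsub hx, rfl⟩
      exact Or.inr ⟨φ i, φ j, hne, Finset.mem_sdiff.2 ⟨hX i hi, hfree i hi⟩,
        Finset.mem_sdiff.2 ⟨hX j hj, hfree j hj⟩, step i j hi hj hij, step j i hj hi hij.symm⟩

/-- Iterated halving: if `2 ^ |P| * m` indices `i` are available, then Waiter makes Client own
`φ p i` for all `p ∈ P` at once, for `m` of the indices. -/
theorem reach_half_all {ι κ : Type*} [DecidableEq ι] [DecidableEq κ] {X : Finset α}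
    (φ : κ → ι → α) (m : ℕ) (P : Finset κ) :
    ∀ (I : Finset ι) (C W : Finset α), 2 ^ P.card * m ≤ I.card →
      (∀ p ∈ P, ∀ q ∈ P, ∀ i ∈ I, ∀ j ∈ I, φ p i = φ q j → p = q ∧ i = j) →
      (∀ p ∈ P, ∀ i ∈ I, φ p i ∈ X) → (∀ p ∈ P, ∀ i ∈ I, φ p i ∉ C ∪ W) →
      Reach X (fun C' W' => ∃ J ⊆ I, J.card = m ∧ (∀ p ∈ P, ∀ j ∈ J, φ p j ∈ C') ∧
        Within {e | ∃ p ∈ P, ∃ i ∈ I, φ p i = e} C W C' W') (2 ^ P.card * m) C W := by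
  induction P using Finset.induction_on with
  | empty =>
      intro I C W hI _ _ _
      obtain ⟨J, hJ, hJc⟩ := Finset.exists_subset_card_eq (show m ≤ I.card by simpa using hI)
      exact Reach.of_now ⟨J, hJ, hJc, by simp, Within.refl _ _ _⟩
  | insert p P hp ih =>
      intro I C W hI hinj hX hfree
      rw [Finset.card_insert_of_notMem hp] at hI ⊢
      have hpI := Finset.mem_insert_self p P
      have h₁ := reach_half (X := X) (φ p) (2 ^ P.card * m) I C W (by rw [pow_succ] at hI; lia)
        (fun i hi j hj h => (hinj p hpI p hpI i hi j hj h).2) (hX p hpI) (hfree p hpI)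
      rw [show 2 ^ (P.card + 1) * m = 2 ^ P.card * m + 2 ^ P.card * m by ring]
      refine h₁.bind ?_
      rintro C₁ W₁ ⟨J, hJ, hJc, hJC, hW⟩
      refine (ih J C₁ W₁ hJc.ge ?_ ?_ ?_).mono ?_
      · exact fun q hq r hr i hi j hj h => hinj q (Finset.mem_insert_of_mem hq) r
          (Finset.mem_insert_of_mem hr) i (hJ hi) j (hJ hj) h
      · exact fun q hq i hi => hX q (Finset.mem_insert_of_mem hq) i (hJ hi)
      · intro q hq i hi
        refine hW.notMem (hfree q (Finset.mem_insert_of_mem hq) i (hJ hi)) ?_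
        rintro ⟨j, hj, h⟩
        have := (hinj p hpI q (Finset.mem_insert_of_mem hq) j hj i (hJ hi) h).1
        exact hp (this ▸ hq)
      · rintro C₂ W₂ ⟨J', hJ', hJc', hJC', hW'⟩
        refine ⟨J', hJ'.trans hJ, hJc', ?_, hW.trans hW' ?_ ?_⟩
        · intro q hq j hj
          rcases Finset.mem_insert.1 hq with rfl | hq
          · exact hW'.1 (hJC j (hJ' hj))
          · exact hJC' q hq j hj
        · rintro _ ⟨i, hi, rfl⟩
          exact ⟨p, hpI, i, hi, rfl⟩
        · rintro _ ⟨q, hq, i, hi, rfl⟩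
          exact ⟨q, Finset.mem_insert_of_mem hq, i, hJ hi, rfl⟩

end Reach
/-! ### Cliques and tilings in Client's graph -/

section Tilings

variable {n : ℕ}

/-- The vertices of `K` are pairwise joined by edges of `C`. -/
def CliqueIn (C : Finset (Sym2 (Fin n))) (K : Finset (Fin n)) : Prop :=
  ∀ a ∈ K, ∀ b ∈ K, a ≠ b → s(a, b) ∈ C

/-- No edge inside `S` belongs to the set `U` of claimed edges. -/
def Fresh (U : Finset (Sym2 (Fin n))) (S : Finset (Fin n)) : Prop :=
  ∀ a ∈ S, ∀ b ∈ S, a ≠ b → s(a, b) ∉ U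

/-- The pairs inside `S` that meet `K`. -/
def touching (S K : Finset (Fin n)) : Set (Sym2 (Fin n)) :=
  {e | (∀ v ∈ e, v ∈ S) ∧ ∃ v ∈ e, v ∈ K}

/-- The vertex set `U` can be partitioned into `k`-cliques of the graph `C`. -/
def Tiles (C : Finset (Sym2 (Fin n))) (k : ℕ) (U : Finset (Fin n)) : Prop :=
  ∃ T : Finset (Finset (Fin n)), (T : Set (Finset (Fin n))).PairwiseDisjoint id ∧
    T.biUnion id = U ∧ ∀ K ∈ T, K.card = k ∧ CliqueIn C K

theorem mem_board {e : Sym2 (Fin n)} : e ∈ board n ↔ ¬ e.IsDiag := by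
  simp [board]

theorem mk_mem_board {a b : Fin n} : s(a, b) ∈ board n ↔ a ≠ b := by
  simp [mem_board]

theorem CliqueIn.mono {C C' : Finset (Sym2 (Fin n))} (h : C ⊆ C') {K : Finset (Fin n)}
    (hK : CliqueIn C K) : CliqueIn C' K :=
  fun a ha b hb hab => h (hK a ha b hb hab)

theorem CliqueIn.subset {C : Finset (Sym2 (Fin n))} {K K' : Finset (Fin n)} (h : K' ⊆ K)
    (hK : CliqueIn C K) : CliqueIn C K' :=
  fun a ha b hb hab => hK a (h ha) b (h hb) hab

theorem CliqueIn.insert {C : Finset (Sym2 (Fin n))} {K : Finset (Fin n)} (hK : CliqueIn C K)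
    {v : Fin n} (hv : ∀ x ∈ K, s(v, x) ∈ C) : CliqueIn C (insert v K) := by
  intro a ha b hb hab
  rcases Finset.mem_insert.1 ha with rfl | ha' <;> rcases Finset.mem_insert.1 hb with rfl | hb'
  · exact absurd rfl hab
  · exact hv b hb'
  · rw [Sym2.eq_swap]
    exact hv a ha'
  · exact hK a ha' b hb' hab

theorem touching_mono {S S' K K' : Finset (Fin n)} (hS : S ⊆ S') (hK : K ⊆ K') :
    touching S K ⊆ touching S' K' :=
  fun _ he => ⟨fun v hv => hS (he.1 v hv), he.2.imp fun _ hv => ⟨hv.1, hK hv.2⟩⟩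

theorem Tiles.mono {C C' : Finset (Sym2 (Fin n))} (h : C ⊆ C') {k : ℕ} {U : Finset (Fin n)} :
    Tiles C k U → Tiles C' k U
  | ⟨T, h₁, h₂, h₃⟩ => ⟨T, h₁, h₂, fun K hK => ⟨(h₃ K hK).1, (h₃ K hK).2.mono h⟩⟩

theorem Tiles.union {C : Finset (Sym2 (Fin n))} {k : ℕ} {U U' : Finset (Fin n)}
    (h : Tiles C k U) (h' : Tiles C k U') (hd : Disjoint U U') : Tiles C k (U ∪ U') := by
  obtain ⟨T, h₁, rfl, h₃⟩ := h
  obtain ⟨T', h₁', rfl, h₃'⟩ := h'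
  refine ⟨T ∪ T', ?_, Finset.union_biUnion, ?_⟩
  · rw [Finset.coe_union, Set.pairwiseDisjoint_union]
    exact ⟨h₁, h₁', fun K hK K' hK' _ => hd.mono
      (Finset.subset_biUnion_of_mem id hK) (Finset.subset_biUnion_of_mem id hK')⟩
  · intro K hK
    exact (Finset.mem_union.1 hK).elim (h₃ K) (h₃' K)

theorem tiles_biUnion {C : Finset (Sym2 (Fin n))} {k : ℕ} {ι : Type*}
    (I : Finset ι) (A : ι → Finset (Fin n)) (hA : ∀ i ∈ I, (A i).card = k ∧ CliqueIn C (A i))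
    (hd : ∀ i ∈ I, ∀ j ∈ I, i ≠ j → Disjoint (A i) (A j)) : Tiles C k (I.biUnion A) := by
  refine ⟨I.image A, ?_, by rw [Finset.image_biUnion]; rfl, ?_⟩
  · intro K hK K' hK' hne
    obtain ⟨i, hi, rfl⟩ := Finset.mem_image.1 hK
    obtain ⟨j, hj, rfl⟩ := Finset.mem_image.1 hK'
    exact hd i hi j hj fun h => hne (h ▸ rfl)
  · intro K hK
    obtain ⟨i, hi, rfl⟩ := Finset.mem_image.1 hK
    exact hA i hi

theorem Tiles.exists_cliqueFactor {C : Finset (Sym2 (Fin n))} {k : ℕ} (hk : 1 ≤ k)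
    (h : Tiles C k Finset.univ) : ∃ F ∈ cliqueFactors n k, F ⊆ C := by
  obtain ⟨T, h₁, h₂, h₃⟩ := h
  let P : Finpartition (Finset.univ : Finset (Fin n)) :=
    { parts := T
      supIndep := Finset.supIndep_iff_pairwiseDisjoint.2 h₁
      sup_parts := by rw [← h₂, Finset.sup_eq_biUnion]
      bot_notMem := fun hb => by
        have := (h₃ _ hb).1
        simp at this
        omega }
  classical
  refine ⟨(board n).filter fun e => ∃ p ∈ P.parts, ∀ v ∈ e, v ∈ p,
    ⟨P, fun p hp => (h₃ p hp).1, fun e => Finset.mem_filter⟩, ?_⟩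
  intro e he
  obtain ⟨heb, p, hp, hep⟩ := Finset.mem_filter.1 he
  induction e using Sym2.ind with
  | _ a b => exact (h₃ p hp).2 a (hep a (by simp)) b (hep b (by simp)) (mk_mem_board.1 heb)

/-- The absorption step. Client's graph contains disjoint cliques `Q i`, a tiling of all the
remaining vertices but `L`, a tiling of a set `D` of `|L|` distinguished vertices `u j`, and all
edges from `L` to `Q j \ {u j}`. Swapping the vertices of `L` for those of `D` gives a tiling of
everything. -/
theorem tiles_univ_of_swap {C : Finset (Sym2 (Fin n))} {k N : ℕ} (Q : Fin N → Finset (Fin n))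
    (hQ : ∀ i, (Q i).card = k ∧ CliqueIn C (Q i)) (hQd : ∀ i j, i ≠ j → Disjoint (Q i) (Q j))
    (u : Fin N → Fin n) (hu : ∀ i, u i ∈ Q i) {L D : Finset (Fin n)} {J : Finset (Fin N)}
    (hL : ∀ i, ∀ v ∈ L, v ∉ Q i)
    (hrest : Tiles C k ((Finset.univ \ Finset.univ.biUnion Q) \ L))
    (hDJ : D ⊆ J.image u) (hDL : D.card = L.card) (hD : Tiles C k D)
    (hatt : ∀ j ∈ J, ∀ v ∈ L, ∀ x ∈ Q j, x ≠ u j → s(v, x) ∈ C) : Tiles C k Finset.univ := by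
  classical
  have huinj : Function.Injective u := by
    intro i j hij
    by_contra hne
    exact Finset.disjoint_left.1 (hQd i j hne) (hu i) (hij ▸ hu j)
  set J' := J.filter fun j => u j ∈ D with hJ'
  have hJ'D : J'.image u = D := by
    ext x
    simp only [hJ', Finset.mem_image, Finset.mem_filter]
    constructor
    · rintro ⟨j, ⟨_, h⟩, rfl⟩
      exact h
    · intro hx
      obtain ⟨j, hj, rfl⟩ := Finset.mem_image.1 (hDJ hx)
      exact ⟨j, ⟨hj, hx⟩, rfl⟩
  have hmemJ' : ∀ j, j ∈ J' ↔ u j ∈ D := by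
    intro j
    rw [← hJ'D]
    exact (huinj.mem_finset_image).symm
  have hcard : J'.card = L.card := by
    rw [← hDL, ← hJ'D, Finset.card_image_of_injective _ huinj]
  let e : J' ≃ L := Finset.equivOfCardEq hcard
  -- Outside `J'` the clique keeps its own distinguished vertex.
  let σ : Fin N → Fin n := fun i => if h : i ∈ J' then (e ⟨i, h⟩ : Fin n) else u i
  have hσL : ∀ i ∈ J', σ i ∈ L := by
    intro i hi
    simp only [σ, hi, dif_pos]
    exact (e ⟨i, hi⟩).2
  have hσu : ∀ i, i ∉ J' → σ i = u i := by
    intro i hi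
    simp only [σ, hi, dif_neg, not_false_iff]
  have hσinj : ∀ i ∈ J', ∀ j ∈ J', σ i = σ j → i = j := by
    intro i hi j hj h
    simp only [σ, hi, hj, dif_pos] at h
    have := e.injective (Subtype.ext h)
    exact congrArg Subtype.val this
  have hσsurj : ∀ v ∈ L, ∃ i ∈ J', σ i = v := by
    intro v hv
    refine ⟨e.symm ⟨v, hv⟩, (e.symm ⟨v, hv⟩).2, ?_⟩
    simp only [σ, (e.symm ⟨v, hv⟩).2, dif_pos, Subtype.coe_eta, Equiv.apply_symm_apply]
  let Q' : Fin N → Finset (Fin n) := fun i => insert (σ i) ((Q i).erase (u i))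
  have hσQ : ∀ i j, σ i ∉ (Q j).erase (u j) := by
    intro i j hmem
    by_cases hi : i ∈ J'
    · exact hL j _ (hσL i hi) (Finset.mem_of_mem_erase hmem)
    · rw [hσu i hi] at hmem
      by_cases hij : i = j
      · subst hij
        simp at hmem
      · exact Finset.disjoint_left.1 (hQd i j hij) (hu i) (Finset.mem_of_mem_erase hmem)
  have hQ' : ∀ i ∈ (Finset.univ : Finset (Fin N)), (Q' i).card = k ∧ CliqueIn C (Q' i) := by
    intro i _
    refine ⟨?_, ((hQ i).2.subset (Finset.erase_subset _ _)).insert ?_⟩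
    · rw [Finset.card_insert_of_notMem (hσQ i i), Finset.card_erase_add_one (hu i), (hQ i).1]
    · intro x hx
      obtain ⟨hxu, hxQ⟩ := Finset.mem_erase.1 hx
      by_cases hi : i ∈ J'
      · exact hatt i (Finset.mem_filter.1 hi).1 _ (hσL i hi) x hxQ hxu
      · rw [hσu i hi]
        exact (hQ i).2 _ (hu i) x hxQ hxu.symm
  have hσne : ∀ i j, i ≠ j → σ i ≠ σ j := by
    intro i j hij h
    by_cases hi : i ∈ J' <;> by_cases hj : j ∈ J'
    · exact hij (hσinj i hi j hj h)
    · exact hL j _ (hσL i hi) (h ▸ hσu j hj ▸ hu j)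
    · exact hL i _ (hσL j hj) (h ▸ hσu i hi ▸ hu i)
    · rw [hσu i hi, hσu j hj] at h
      exact hij (huinj h)
  have hQ'd : ∀ i ∈ (Finset.univ : Finset (Fin N)), ∀ j ∈ (Finset.univ : Finset (Fin N)),
      i ≠ j → Disjoint (Q' i) (Q' j) := by
    intro i _ j _ hij
    rw [Finset.disjoint_insert_left, Finset.disjoint_insert_right]
    refine ⟨?_, hσQ j i, (hQd i j hij).mono (Finset.erase_subset _ _) (Finset.erase_subset _ _)⟩
    rw [Finset.mem_insert, not_or]
    exact ⟨hσne i j hij, hσQ i j⟩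
  have hDQ' : Disjoint D (Finset.univ.biUnion Q') := by
    rw [Finset.disjoint_left]
    intro x hx hx'
    obtain ⟨j, _, rfl⟩ := Finset.mem_image.1 (hDJ hx)
    obtain ⟨i, _, hi⟩ := Finset.mem_biUnion.1 hx'
    rcases Finset.mem_insert.1 hi with h | h
    · by_cases hiJ : i ∈ J'
      · exact hL j _ (hσL i hiJ) (h ▸ hu j)
      · rw [hσu i hiJ] at h
        exact hiJ ((hmemJ' i).2 (h ▸ hx))
    · by_cases hij : i = j
      · subst hij
        simp at h
      · exact Finset.disjoint_left.1 (hQd i j hij) (Finset.mem_of_mem_erase h) (hu j)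
  have hrestd : Disjoint ((Finset.univ \ Finset.univ.biUnion Q) \ L)
      (D ∪ Finset.univ.biUnion Q') := by
    rw [Finset.disjoint_left]
    intro x hx hx'
    simp only [Finset.mem_sdiff, Finset.mem_univ, true_and, Finset.mem_biUnion, not_exists] at hx
    rcases Finset.mem_union.1 hx' with h | h
    · obtain ⟨j, _, rfl⟩ := Finset.mem_image.1 (hDJ h)
      exact hx.1 j (hu j)
    · obtain ⟨i, _, hi⟩ := Finset.mem_biUnion.1 h
      rcases Finset.mem_insert.1 hi with h | h
      · by_cases hiJ : i ∈ J'
        · exact hx.2 (h ▸ hσL i hiJ)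
        · exact hx.1 i (h ▸ hσu i hiJ ▸ hu i)
      · exact hx.1 i (Finset.mem_of_mem_erase h)
  have hall := hrest.union (hD.union (tiles_biUnion Finset.univ Q' hQ' hQ'd) hDQ') hrestd
  convert hall using 1
  ext x
  simp only [Finset.mem_univ, Finset.mem_union, Finset.mem_sdiff, Finset.mem_biUnion, true_and,
    not_exists, true_iff]
  by_cases hxL : x ∈ L
  · obtain ⟨i, _, rfl⟩ := hσsurj x hxL
    exact Or.inr (Or.inr ⟨i, Finset.mem_insert_self _ _⟩)
  by_cases hxQ : ∃ i, x ∈ Q i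
  · obtain ⟨i, hi⟩ := hxQ
    by_cases hxu : x = u i
    · by_cases hxD : x ∈ D
      · exact Or.inr (Or.inl hxD)
      · refine Or.inr (Or.inr ⟨i, ?_⟩)
        have : i ∉ J' := fun h => hxD (hxu ▸ (hmemJ' i).1 h)
        exact Finset.mem_insert.2 (Or.inl (by rw [hσu i this, hxu]))
    · exact Or.inr (Or.inr ⟨i, Finset.mem_insert_of_mem (Finset.mem_erase.2 ⟨hxu, hi⟩)⟩)
  · exact Or.inl ⟨fun i hi => hxQ ⟨i, hi⟩, hxL⟩

/-! ### Waiter's strategy -/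

/-- Waiter forces a `k`-clique inside a fresh set of `2 ^ k - 1` vertices: she halves the star of
one vertex and continues inside the neighbourhood that Client has chosen. All edges claimed on the
way meet the clique. -/
theorem reach_clique (k : ℕ) :
    ∀ (S : Finset (Fin n)) (C W : Finset (Sym2 (Fin n))), 2 ^ k ≤ S.card + 1 →
      Fresh (C ∪ W) S →
      Reach (board n) (fun C' W' => ∃ K ⊆ S, K.card = k ∧ CliqueIn C' K ∧
        Within (touching S K) C W C' W') (2 ^ k) C W := by
  induction k with
  | zero =>
      intro S C W _ _
      exact Reach.of_now ⟨∅, by simp, rfl, by simp [CliqueIn], Within.refl _ _ _⟩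
  | succ k ih =>
      intro S C W hS hfree
      have h2k : 1 ≤ 2 ^ k := Nat.one_le_two_pow
      rw [pow_succ] at hS
      obtain ⟨v, hv⟩ : S.Nonempty := Finset.card_pos.1 (by omega)
      have hcard := Finset.card_erase_of_mem hv
      have h₁ := reach_half (X := board n) (fun x => s(v, x)) (2 ^ k - 1) (S.erase v) C W (by omega)
        (fun a _ b _ h => Sym2.congr_right.1 h)
        (fun x hx => mk_mem_board.2 (Finset.ne_of_mem_erase hx).symm)
        (fun x hx => hfree v hv x (Finset.mem_of_mem_erase hx) (Finset.ne_of_mem_erase hx).symm)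
      refine (h₁.bind (t := 2 ^ k) ?_).mono_time (by rw [pow_succ]; omega)
      rintro C₁ W₁ ⟨J, hJ, hJc, hJC, hW⟩
      have hJS : J ⊆ S := hJ.trans (Finset.erase_subset _ _)
      have hvJ : v ∉ J := fun h => by simpa using hJ h
      refine (ih J C₁ W₁ (by omega) ?_).mono ?_
      · intro a ha b hb hab
        refine hW.notMem (hfree a (hJS ha) b (hJS hb) hab) ?_
        rintro ⟨x, _, hx⟩
        rcases Sym2.eq_iff.1 hx with h | h
        · exact hvJ (h.1 ▸ ha)
        · exact hvJ (h.1 ▸ hb)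
      · rintro C₂ W₂ ⟨K, hK, hKc, hKC, hW'⟩
        refine ⟨insert v K, Finset.insert_subset hv (hK.trans hJS), ?_, hKC.insert ?_, ?_⟩
        · rw [Finset.card_insert_of_notMem fun h => hvJ (hK h), hKc]
        · exact fun x hx => hW'.1 (hJC x (hK hx))
        · refine hW.trans hW' ?_ (touching_mono hJS (Finset.subset_insert _ _))
          rintro _ ⟨x, hx, rfl⟩
          refine ⟨fun y hy => ?_, v, by simp, Finset.mem_insert_self _ _⟩
          rcases Sym2.mem_iff.1 hy with rfl | rfl
          · exact hv
          · exact Finset.mem_of_mem_erase hx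

/-- Since the edges claimed by `reach_clique` meet the clique, the other vertices stay fresh, and
the strategy can be repeated until fewer than `2 ^ k - 1` vertices remain. -/
theorem reach_cliques (k : ℕ) (j : ℕ) :
    ∀ (S : Finset (Fin n)) (C W : Finset (Sym2 (Fin n))), j * k + 2 ^ k ≤ S.card + k + 1 →
      Fresh (C ∪ W) S →
      Reach (board n) (fun C' W' => ∃ D ⊆ S, D.card = j * k ∧ Tiles C' k D ∧
        Within (touching S D) C W C' W') (j * 2 ^ k) C W := by
  induction j with
  | zero =>
      intro S C W _ _
      exact Reach.of_now ⟨∅, by simp, by simp, ⟨∅, by simp, by simp, by simp⟩, Within.refl _ _ _⟩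
  | succ j ih =>
      intro S C W hS hfree
      rw [Nat.succ_mul] at hS
      rw [show (j + 1) * 2 ^ k = 2 ^ k + j * 2 ^ k by ring]
      refine (reach_clique k S C W (by omega) hfree).bind ?_
      rintro C₁ W₁ ⟨K, hK, hKc, hKC, hW⟩
      refine (ih (S \ K) C₁ W₁ ?_ ?_).mono ?_
      · rw [Finset.card_sdiff_of_subset hK]
        omega
      · intro a ha b hb hab
        rw [Finset.mem_sdiff] at ha hb
        refine hW.notMem (hfree a ha.1 b hb.1 hab) ?_
        rintro ⟨_, x, hx, hxK⟩
        rcases Sym2.mem_iff.1 hx with rfl | rfl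
        · exact ha.2 hxK
        · exact hb.2 hxK
      · rintro C₂ W₂ ⟨D, hD, hDc, hDC, hW'⟩
        have hdisj : Disjoint K D := by
          rw [Finset.disjoint_left]
          exact fun x hx hx' => (Finset.mem_sdiff.1 (hD hx')).2 hx
        have hKt : Tiles C₂ k K := ⟨{K}, by simp, by simp, by
          simpa using ⟨hKc, hKC.mono hW'.1⟩⟩
        refine ⟨K ∪ D, Finset.union_subset hK (hD.trans Finset.sdiff_subset), ?_,
          hKt.union hDC hdisj, hW.trans hW' ?_ ?_⟩
        · rw [Finset.card_union_of_disjoint hdisj, hKc, hDc, Nat.succ_mul, add_comm]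
        · exact touching_mono subset_rfl Finset.subset_union_left
        · exact touching_mono Finset.sdiff_subset Finset.subset_union_right

/-- In disjoint fresh blocks, Waiter forces one clique in each block, claiming only edges inside
the blocks that meet these cliques. -/
theorem reach_clique_blocks {ι : Type*} [DecidableEq ι] (k : ℕ) (S : ι → Finset (Fin n))
    (hS : ∀ i, 2 ^ k ≤ (S i).card + 1) (hd : ∀ i j, i ≠ j → Disjoint (S i) (S j))
    (I : Finset ι) :
    ∀ C W : Finset (Sym2 (Fin n)), (∀ i ∈ I, Fresh (C ∪ W) (S i)) →
      Reach (board n) (fun C' W' => ∃ Q : ι → Finset (Fin n),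
        (∀ i ∈ I, Q i ⊆ S i ∧ (Q i).card = k ∧ CliqueIn C' (Q i)) ∧
        Within {e | ∃ i ∈ I, e ∈ touching (S i) (Q i)} C W C' W') (I.card * 2 ^ k) C W := by
  induction I using Finset.induction_on with
  | empty =>
      intro C W _
      exact Reach.of_now ⟨fun _ => ∅, by simp, Within.refl _ _ _⟩
  | insert i I hi ih =>
      intro C W hfree
      rw [Finset.card_insert_of_notMem hi, Nat.succ_mul, add_comm]
      refine (reach_clique k (S i) C W (hS i) (hfree i (Finset.mem_insert_self _ _))).bind ?_
      rintro C₁ W₁ ⟨K, hK, hKc, hKC, hW⟩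
      refine (ih C₁ W₁ ?_).mono ?_
      · intro j hj a ha b hb hab
        refine hW.notMem (hfree j (Finset.mem_insert_of_mem hj) a ha b hb hab) fun he => ?_
        have hij : i ≠ j := fun h => hi (h ▸ hj)
        exact Finset.disjoint_left.1 (hd i j hij) (he.1 a (by simp)) ha
      · rintro C₂ W₂ ⟨Q, hQ, hW'⟩
        have hQj : ∀ j ∈ I, Function.update Q i K j = Q j := fun j hj =>
          Function.update_of_ne (fun h : j = i => hi (h ▸ hj)) _ _
        refine ⟨Function.update Q i K, ?_, hW.trans hW' ?_ ?_⟩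
        · intro j hj
          rcases Finset.mem_insert.1 hj with rfl | hj
          · rw [Function.update_self]
            exact ⟨hK, hKc, hKC.mono hW'.1⟩
          · rw [hQj j hj]
            exact hQ j hj
        · intro e he
          refine ⟨i, Finset.mem_insert_self _ _, ?_⟩
          rwa [Function.update_self]
        · rintro e ⟨j, hj, he⟩
          refine ⟨j, Finset.mem_insert_of_mem hj, ?_⟩
          rwa [hQj j hj]

end Tilings
section Strategy

/-- Waiter forces a tiling of all of `K_n`. She first builds `N` reserve cliques in disjoint blocks,
so that the edges between different reserve cliques stay unclaimed, and then tiles greedily until a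
set `L` of fewer than `2 ^ k + k` vertices is left. Halving over the reserve cliques, she joins all
of `L` to `Q j \ {u j}` for many `j`; finally she builds `|L| / k` cliques among the vertices `u j`
and swaps `L` in for them. Every clique costs at most `2 ^ k` rounds, and only the rounds spent on
`L` come on top. -/
theorem reach_tiling {n k N M : ℕ} (hk : 1 ≤ k) (hkn : k ∣ n)
    (hM : 2 ^ ((2 ^ k + k) * (k - 1)) * (2 * 2 ^ k + k) ≤ M) (hN : N = M + 2 ^ k + k)
    (hn : N * 2 ^ k ≤ n) :
    Reach (board n) (fun C _ => Tiles C k Finset.univ) (n / k * 2 ^ k + M) ∅ ∅ := by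
  classical
  have hk2 : k + 1 ≤ 2 ^ k := Nat.lt_two_pow_self
  obtain ⟨f⟩ : Nonempty (Fin N × Fin (2 ^ k) ↪ Fin n) :=
    Function.Embedding.nonempty_of_card_le (by simpa using hn)
  let S : Fin N → Finset (Fin n) := fun i => Finset.univ.image fun r => f (i, r)
  have hSc : ∀ i, 2 ^ k ≤ (S i).card + 1 := by
    intro i
    have : (S i).card = 2 ^ k := by
      rw [Finset.card_image_of_injective, Finset.card_univ, Fintype.card_fin]
      intro a b h
      exact (Prod.mk.inj (f.injective h)).2
    omega
  have hSd : ∀ i j, i ≠ j → Disjoint (S i) (S j) := by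
    intro i j hij
    rw [Finset.disjoint_left]
    intro x hx hx'
    obtain ⟨a, _, rfl⟩ := Finset.mem_image.1 hx
    obtain ⟨b, _, hb⟩ := Finset.mem_image.1 hx'
    exact hij (Prod.mk.inj (f.injective hb)).1.symm
  have h₀ := reach_clique_blocks k S hSc hSd Finset.univ ∅ ∅ (by simp [Fresh])
  rw [Finset.card_univ, Fintype.card_fin] at h₀
  -- The vertices outside the reserve cliques are `n - N * k` many.
  have hNk : N * k + 2 ^ k ≤ n := by
    have : N * (k + 1) ≤ N * 2 ^ k := Nat.mul_le_mul_left _ hk2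
    rw [Nat.mul_succ] at this
    omega
  obtain ⟨c, hc⟩ : k ∣ n - N * k := Nat.dvd_sub hkn (Dvd.intro_left _ rfl)
  set j := (n - N * k + 1 - 2 ^ k) / k with hj
  have hj₁ : j * k ≤ n - N * k + 1 - 2 ^ k := Nat.div_mul_le_self _ _
  have hj₂ : n - N * k + 1 - 2 ^ k < j * k + k := by
    have := Nat.lt_div_mul_add (a := n - N * k + 1 - 2 ^ k) (b := k) (by omega)
    exact this
  obtain ⟨g, hg⟩ : ∃ g, c = j + g := by
    refine Nat.exists_eq_add_of_le (Nat.le_of_mul_le_mul_right (c := k) ?_ (by omega))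
    rw [mul_comm c, ← hc]
    omega
  have hnk : n = (N + j + g) * k := by
    have : n - N * k = (j + g) * k := by rw [hc, hg, mul_comm]
    have h' : n = N * k + (j + g) * k := by omega
    rw [h']
    ring
  have hdiv : n / k = N + j + g := by
    conv_lhs => rw [hnk]
    exact Nat.mul_div_cancel _ (by omega)
  have hgk : N * k + j * k + g * k = n := by
    conv_rhs => rw [hnk]
    ring
  have hgk' : g * k + 1 ≤ 2 ^ k + k := by omega
  refine (h₀.bind (t := j * 2 ^ k + (M + g * 2 ^ k)) ?_).mono_time
    (le_of_eq (by rw [hdiv]; ring))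
  rintro C₀ W₀ ⟨Q, hQ, hW₀⟩
  replace hQ := fun i => hQ i (Finset.mem_univ i)
  have hQd : ∀ i j, i ≠ j → Disjoint (Q i) (Q j) := fun i j hij =>
    (hSd i j hij).mono (hQ i).1 (hQ j).1
  set R := Finset.univ \ Finset.univ.biUnion Q with hR
  have hRc : R.card = n - N * k := by
    rw [hR, Finset.card_sdiff_of_subset (Finset.subset_univ _), Finset.card_biUnion]
    · simp [(hQ _).2.1]
    · exact fun i _ j _ hij => hQd i j hij
  have hRQ : ∀ x ∈ R, ∀ i, x ∉ Q i := by
    intro x hx i hi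
    rw [hR, Finset.mem_sdiff] at hx
    exact hx.2 (Finset.mem_biUnion.2 ⟨i, Finset.mem_univ _, hi⟩)
  refine (reach_cliques k j R C₀ W₀ (by omega) ?_).bind ?_
  · intro a ha b hb _
    refine hW₀.notMem (by simp) ?_
    rintro ⟨i, _, _, x, hx, hxQ⟩
    rcases Sym2.mem_iff.1 hx with rfl | rfl
    · exact hRQ _ ha i hxQ
    · exact hRQ _ hb i hxQ
  rintro C₁ W₁ ⟨D₁, hD₁, hD₁c, hD₁C, hW₁⟩
  set L := R \ D₁ with hL
  have hLc : L.card = g * k := by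
    rw [hL, Finset.card_sdiff_of_subset hD₁]
    omega
  have hLR : L ⊆ R := Finset.sdiff_subset
  -- Edges that leave a block from its reserve clique are unclaimed.
  have hfree₁ : ∀ i, ∀ x ∈ Q i, ∀ y, y ∉ S i → s(x, y) ∉ C₁ ∪ W₁ := by
    intro i x hx y hy hmem
    rcases hW₁.2 _ hmem with h | h
    · rcases hW₀.2 _ h with h | ⟨l, _, h⟩
      · simp at h
      · by_cases hli : l = i
        · exact hy (hli ▸ h.1 y (by simp))
        · exact Finset.disjoint_left.1 (hSd l i hli) (h.1 x (by simp)) ((hQ i).1 hx)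
    · exact hRQ x (h.1 x (by simp)) i hx
  -- Blocks meeting `L` are discarded, at most one for each vertex of `L`.
  let I : Finset (Fin N) := Finset.univ.filter fun i => Disjoint (S i) L
  have hIc : N ≤ I.card + g * k := by
    have hcompl : (Finset.univ.filter fun i => ¬ Disjoint (S i) L).card ≤ L.card := by
      have hex : ∀ i : Fin N, ∃ x, ¬ Disjoint (S i) L → x ∈ S i ∧ x ∈ L := by
        intro i
        by_cases h : Disjoint (S i) L
        · exact ⟨f (i, ⟨0, by positivity⟩), fun h' => absurd h h'⟩
        · obtain ⟨x, hx⟩ := Finset.not_disjoint_iff.1 h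
          exact ⟨x, fun _ => hx⟩
      choose φ hφ using hex
      refine Finset.card_le_card_of_injOn φ
        (fun i hi => (hφ i (Finset.mem_filter.1 hi).2).2) ?_
      intro i hi l hl h
      by_contra hne
      have h₁ := (hφ i (Finset.mem_filter.1 hi).2).1
      have h₂ := (hφ l (Finset.mem_filter.1 hl).2).1
      exact Finset.disjoint_left.1 (hSd i l hne) h₁ (h ▸ h₂)
    have := Finset.card_filter_add_card_filter_not (s := (Finset.univ : Finset (Fin N)))
      (fun i => Disjoint (S i) L)
    rw [Finset.card_univ, Fintype.card_fin] at this
    change I.card + _ = N at this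
    omega
  let q : Fin N → Fin k → Fin n := fun i => (Q i).orderEmbOfFin (hQ i).2.1
  have hqQ : ∀ i a, q i a ∈ Q i := fun i a => Finset.orderEmbOfFin_mem _ _ _
  have hqinj : ∀ i l a b, q i a = q l b → i = l ∧ a = b := by
    intro i l a b h
    by_cases hil : i = l
    · subst hil
      exact ⟨rfl, ((Q i).orderEmbOfFin (hQ i).2.1).injective h⟩
    · exact absurd (h ▸ hqQ l b) (Finset.disjoint_left.1 (hQd i l hil) (hqQ i a))
  let z : Fin k := ⟨0, hk⟩
  let P : Finset (Fin n × Fin k) := L ×ˢ Finset.univ.erase z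
  have hPc : P.card = g * k * (k - 1) := by
    rw [Finset.card_product, hLc, Finset.card_erase_of_mem (Finset.mem_univ _), Finset.card_univ,
      Fintype.card_fin]
  have hPM : 2 ^ P.card * (g * k + 2 ^ k) ≤ M := by
    refine le_trans (Nat.mul_le_mul (Nat.pow_le_pow_right (by norm_num) ?_) ?_) hM
    · rw [hPc]
      exact Nat.mul_le_mul_right _ (by omega)
    · omega
  have hLQ : ∀ v ∈ L, ∀ i, v ∉ Q i := fun v hv => hRQ v (hLR hv)
  have hatt := reach_half_all (X := board n) (fun (p : Fin n × Fin k) i => s(p.1, q i p.2))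
    (g * k + 2 ^ k) P I C₁ W₁ (by omega)
    (by
      rintro ⟨v, a⟩ hp ⟨w, b⟩ hp' i _ l _ h
      have hv := (Finset.mem_product.1 hp).1
      have hw := (Finset.mem_product.1 hp').1
      rcases Sym2.eq_iff.1 h with ⟨h₁, h₂⟩ | ⟨h₁, _⟩
      · obtain ⟨h₃, h₄⟩ := hqinj _ _ _ _ h₂
        exact ⟨Prod.ext h₁ h₄, h₃⟩
      · dsimp only at h₁ hv
        exact absurd (hqQ l b) (h₁ ▸ hLQ v hv l))
    (by
      rintro ⟨v, a⟩ hp i _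
      have hv := (Finset.mem_product.1 hp).1
      refine mk_mem_board.2 fun h => hLQ v hv i ?_
      dsimp only at h
      exact h ▸ hqQ i a)
    (by
      rintro ⟨v, a⟩ hp i hi
      have hv := (Finset.mem_product.1 hp).1
      rw [Sym2.eq_swap]
      exact hfree₁ i _ (hqQ i a) v fun h =>
        Finset.disjoint_left.1 (Finset.mem_filter.1 hi).2 h hv)
  refine ((hatt.mono_time hPM).bind (t := g * 2 ^ k) ?_)
  rintro C₂ W₂ ⟨J, hJ, hJc, hJC, hW₂⟩
  let u : Fin N → Fin n := fun i => q i z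
  have huinj : Function.Injective u := fun i l h => (hqinj i l z z h).1
  refine (reach_cliques k g (J.image u) C₂ W₂ ?_ ?_).mono ?_
  · rw [Finset.card_image_of_injective _ huinj, hJc]
    omega
  · intro a ha b hb hab
    obtain ⟨i, hi, rfl⟩ := Finset.mem_image.1 ha
    obtain ⟨l, hl, rfl⟩ := Finset.mem_image.1 hb
    have hil : i ≠ l := fun h => hab (h ▸ rfl)
    refine hW₂.notMem (hfree₁ i _ (hqQ i z) _ fun h => ?_) ?_
    · exact Finset.disjoint_left.1 (hSd i l hil) h ((hQ l).1 (hqQ l z))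
    · rintro ⟨⟨v, a⟩, hp, m, _, h⟩
      have hv := (Finset.mem_product.1 hp).1
      rcases Sym2.eq_iff.1 h with ⟨h₁, _⟩ | ⟨h₁, _⟩
      · exact hLQ v hv i (by dsimp only at h₁; exact h₁ ▸ hqQ i z)
      · exact hLQ v hv l (by dsimp only at h₁; exact h₁ ▸ hqQ l z)
  · rintro C₃ W₃ ⟨D, hD, hDc, hDC, hW₃⟩
    have h₀₃ : C₀ ⊆ C₃ := hW₁.1.trans (hW₂.1.trans hW₃.1)
    refine tiles_univ_of_swap Q (fun i => ⟨(hQ i).2.1, (hQ i).2.2.mono h₀₃⟩) hQd u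
      (fun i => hqQ i z) (fun i v hv => hLQ v hv i) (L := L) ?_ hD (hDc.trans hLc.symm) hDC ?_
    · rw [← hR, hL, Finset.sdiff_sdiff_eq_self hD₁]
      exact hD₁C.mono (hW₂.1.trans hW₃.1)
    · intro i hi v hv x hx hxu
      obtain ⟨a, rfl⟩ : ∃ a, q i a = x := by
        have : x ∈ Set.range ((Q i).orderEmbOfFin (hQ i).2.1) := by
          rw [Finset.range_orderEmbOfFin]
          exact hx
        exact this
      have haz : a ≠ z := fun h => hxu (h ▸ rfl)
      exact hW₃.1 (hJC (v, a) (Finset.mem_product.2 ⟨hv, Finset.mem_erase.2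
        ⟨haz, Finset.mem_univ _⟩⟩) i hi)

theorem absorption_cost_le {k : ℕ} (hk : 1 ≤ k) :
    2 ^ ((2 ^ k + k) * (k - 1)) * (2 * 2 ^ k + k) ≤ 2 ^ 8 ^ k := by
  have hk2 : k + 1 ≤ 2 ^ k := Nat.lt_two_pow_self
  have h₁ : 2 * 2 ^ k + k ≤ 2 ^ (k + 2) := by
    rw [pow_add]
    omega
  refine (Nat.mul_le_mul_left _ h₁).trans ?_
  rw [← pow_add]
  refine Nat.pow_le_pow_right (by norm_num) ?_
  obtain ⟨m, rfl⟩ := Nat.exists_eq_add_of_le' hk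
  have h8 : 8 ^ (m + 1) = 2 ^ (m + 1) * 2 ^ (m + 1) * 2 ^ (m + 1) := by
    rw [← mul_pow, ← mul_pow]
    norm_num
  rw [h8]
  generalize 2 ^ (m + 1) = x at *
  simp only [Nat.add_sub_cancel]
  nlinarith [mul_le_mul hk2 hk2 (by omega) (by omega), Nat.zero_le (x * m), Nat.zero_le m]

end Strategy
/-! ### Client's strategy from a potential function -/

section Potential

/-- If the average of `Φ` over Client's two answers never exceeds its current value, then Client
can keep `Φ` from growing until Waiter has won. -/
theorem ForcesWithin.exists_final {α : Type*} [DecidableEq α] {X : Finset α}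
    {𝓕 : Set (Finset α)} {Φ : Finset α → Finset α → ℝ}
    (step : ∀ C W e f, Disjoint C W → C ∪ W ⊆ X → e ∈ X \ (C ∪ W) → f ∈ X \ (C ∪ W) → e ≠ f →
      Φ (insert e C) (insert f W) + Φ (insert f C) (insert e W) ≤ 2 * Φ C W) :
    ∀ (t : ℕ) (C W : Finset α), Disjoint C W → C ∪ W ⊆ X → ForcesWithin X 1 𝓕 t C W →
      ∃ C' W', Disjoint C' W' ∧ C' ∪ W' ⊆ X ∧ C'.card ≤ C.card + t ∧ W'.card ≤ W.card + t ∧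
        Φ C' W' ≤ Φ C W ∧ ∃ F ∈ 𝓕, F ⊆ C' := by
  intro t
  induction t with
  | zero => exact fun C W hd hX h => ⟨C, W, hd, hX, le_rfl, le_rfl, le_rfl, h⟩
  | succ t ih =>
      rintro C W hd hX (h | ⟨O, hO, hOc, h⟩)
      · exact ⟨C, W, hd, hX, by omega, by omega, le_rfl, h⟩
      · obtain ⟨e, f, hef, rfl⟩ := Finset.card_eq_two.1 hOc
        have answer : ∀ a b, a ≠ b → ({e, f} : Finset α) = {a, b} →
            Φ (insert a C) (insert b W) ≤ Φ C W →
            ∃ C' W', Disjoint C' W' ∧ C' ∪ W' ⊆ X ∧ C'.card ≤ C.card + (t + 1) ∧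
              W'.card ≤ W.card + (t + 1) ∧ Φ C' W' ≤ Φ C W ∧ ∃ F ∈ 𝓕, F ⊆ C' := by
          intro a b hab heq hΦ
          rw [heq] at hO h
          have hW : W ∪ ({a, b} : Finset α).erase a = insert b W := by
            ext z
            simp only [Finset.mem_union, Finset.mem_erase, Finset.mem_insert,
              Finset.mem_singleton]
            grind
          have ha := Finset.mem_sdiff.1 (hO (Finset.mem_insert_self a _))
          have hb := Finset.mem_sdiff.1 (hO (show b ∈ ({a, b} : Finset α) by simp))
          simp only [Finset.mem_union, not_or] at ha hb
          have := h a (Finset.mem_insert_self a _)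
          rw [hW] at this
          obtain ⟨C', W', h₁, h₂, h₃, h₄, h₅, h₆⟩ := ih _ _
            (by
              rw [Finset.disjoint_insert_left, Finset.disjoint_insert_right, Finset.mem_insert]
              exact ⟨fun h => h.elim hab ha.2.2, hb.2.1, hd⟩)
            (by
              intro z hz
              simp only [Finset.mem_union, Finset.mem_insert] at hz
              rcases hz with (rfl | hz) | (rfl | hz)
              · exact ha.1
              · exact hX (Finset.mem_union_left _ hz)
              · exact hb.1
              · exact hX (Finset.mem_union_right _ hz)) this
          have h₇ := Finset.card_insert_le a C
          have h₈ := Finset.card_insert_le b W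
          exact ⟨C', W', h₁, h₂, by omega, by omega, h₅.trans hΦ, h₆⟩
        have hs := step C W e f hd hX (hO (Finset.mem_insert_self e _))
          (hO (show f ∈ ({e, f} : Finset α) by simp)) hef
        rcases le_total (Φ (insert e C) (insert f W)) (Φ (insert f C) (insert e W)) with hle | hle
        · exact answer e f hef rfl (by linarith)
        · exact answer f e hef.symm (Finset.pair_comm _ _) (by linarith)

end Potential

/-! ### Connected vertex sets -/

section Connected

variable {n : ℕ}

/-- The nonempty vertex set `A` induces a connected subgraph of `C`: every cut of `A` is crossed
by an edge of `C`. -/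
def Conn (C : Finset (Sym2 (Fin n))) (A : Finset (Fin n)) : Prop :=
  A.Nonempty ∧ ∀ S ⊆ A, S.Nonempty → S ≠ A → ∃ x ∈ S, ∃ y ∈ A \ S, s(x, y) ∈ C

/-- The number of edges of `U` at `v`. -/
def dg (U : Finset (Sym2 (Fin n))) (v : Fin n) : ℕ :=
  (U.filter (v ∈ ·)).card

theorem Conn.mono {C C' : Finset (Sym2 (Fin n))} (h : C ⊆ C') {A : Finset (Fin n)}
    (hA : Conn C A) : Conn C' A :=
  ⟨hA.1, fun S hS hne hSA =>
    let ⟨x, hx, y, hy, hxy⟩ := hA.2 S hS hne hSA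
    ⟨x, hx, y, hy, h hxy⟩⟩

theorem dg_mono {U U' : Finset (Sym2 (Fin n))} (h : U ⊆ U') (v : Fin n) : dg U v ≤ dg U' v :=
  Finset.card_le_card (Finset.filter_subset_filter _ h)

theorem CliqueIn.conn {C : Finset (Sym2 (Fin n))} {K : Finset (Fin n)} (hK : CliqueIn C K)
    (hne : K.Nonempty) : Conn C K := by
  refine ⟨hne, fun S hS ⟨x, hx⟩ hSK => ?_⟩
  obtain ⟨y, hy⟩ := Finset.sdiff_nonempty.2 fun h => hSK (hS.antisymm h)
  exact ⟨x, hx, y, hy, hK x (hS hx) y (Finset.mem_sdiff.1 hy).1 fun h =>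
    (Finset.mem_sdiff.1 hy).2 (h ▸ hx)⟩

theorem conn_of_cut {C : Finset (Sym2 (Fin n))} {K S : Finset (Fin n)} {x y : Fin n}
    (hK : Conn (insert s(x, y) C) K) (hS : S ⊆ K) (hx : x ∈ S) (hy : y ∈ K \ S)
    (hcut : ∀ a ∈ S, ∀ b ∈ K \ S, s(a, b) ∉ C) : Conn C S := by
  refine ⟨⟨x, hx⟩, fun T hT hne hTS => ?_⟩
  -- The side of the cut `(T, S \ T)` that avoids `x` is joined to the rest of `K` by an edge of `C`.
  have side : ∀ T ⊆ S, T.Nonempty → x ∉ T → ∃ a ∈ T, ∃ b ∈ S \ T, s(a, b) ∈ C := by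
    intro T hT hne hxT
    obtain ⟨a, ha, b, hb, hab⟩ := hK.2 T (hT.trans hS) hne fun h => hxT (h ▸ hS hx)
    rw [Finset.mem_sdiff] at hb
    rcases Finset.mem_insert.1 hab with h | h
    · exfalso
      rcases Sym2.eq_iff.1 h with ⟨rfl, _⟩ | ⟨rfl, _⟩
      · exact hxT ha
      · exact (Finset.mem_sdiff.1 hy).2 (hT ha)
    · refine ⟨a, ha, b, Finset.mem_sdiff.2 ⟨?_, hb.2⟩, h⟩
      by_contra hbS
      exact hcut a (hT ha) b (Finset.mem_sdiff.2 ⟨hb.1, hbS⟩) h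
  by_cases hxT : x ∈ T
  · obtain ⟨a, ha, b, hb, hab⟩ := side (S \ T) Finset.sdiff_subset
      (Finset.sdiff_nonempty.2 fun h => hTS (hT.antisymm h)) (by simp [hxT])
    rw [Finset.sdiff_sdiff_eq_self hT] at hb
    exact ⟨b, hb, a, ha, Sym2.eq_swap (a := a) ▸ hab⟩
  · exact side T hT hne hxT

/-- If the edge `xy` makes `K` connected, then it joins two connected parts of `K` between which
there was no edge before. The larger part is named first. -/
theorem Conn.exists_split {C : Finset (Sym2 (Fin n))} {K : Finset (Fin n)} {x y : Fin n}
    (hK : Conn (insert s(x, y) C) K) (hK' : ¬ Conn C K) :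
    ∃ A B, Disjoint A B ∧ A ∪ B = K ∧ Conn C A ∧ Conn C B ∧ B.card ≤ A.card ∧
      (∀ a ∈ A, ∀ b ∈ B, s(a, b) ∉ C) ∧ ((x ∈ A ∧ y ∈ B) ∨ (y ∈ A ∧ x ∈ B)) := by
  have hcut : ∃ S ⊆ K, S.Nonempty ∧ S ≠ K ∧ ∀ a ∈ S, ∀ b ∈ K \ S, s(a, b) ∉ C := by
    by_contra hcon
    push Not at hcon
    exact hK' ⟨hK.1, hcon⟩
  obtain ⟨S, hS, hne, hSK, hcut⟩ := hcut
  obtain ⟨a, ha, b, hb, hab⟩ := hK.2 S hS hne hSK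
  have he := (Finset.mem_insert.1 hab).resolve_right (hcut a ha b hb)
  have hcut' : ∀ b ∈ K \ S, ∀ a ∈ K \ (K \ S), s(b, a) ∉ C := by
    intro b hb a ha
    rw [Finset.sdiff_sdiff_eq_self hS] at ha
    rw [Sym2.eq_swap]
    exact hcut a ha b hb
  have h₁ : Conn C S := conn_of_cut (he ▸ hK) hS ha hb hcut
  have h₂ : Conn C (K \ S) := by
    refine conn_of_cut (x := b) (y := a) ?_ Finset.sdiff_subset hb ?_ hcut'
    · rwa [Sym2.eq_swap, he]
    · rwa [Finset.sdiff_sdiff_eq_self hS]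
  have hor : (x ∈ S ∧ y ∈ K \ S) ∨ (y ∈ S ∧ x ∈ K \ S) := by
    rcases Sym2.eq_iff.1 he with ⟨rfl, rfl⟩ | ⟨rfl, rfl⟩
    · exact Or.inl ⟨ha, hb⟩
    · exact Or.inr ⟨ha, hb⟩
  rcases le_total (K \ S).card S.card with hle | hle
  · exact ⟨S, K \ S, Finset.disjoint_sdiff, Finset.union_sdiff_of_subset hS, h₁, h₂, hle, hcut,
      hor⟩
  · refine ⟨K \ S, S, Finset.sdiff_disjoint, Finset.sdiff_union_of_subset hS, h₂, h₁, hle, ?_,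
      hor.symm.imp And.symm And.symm⟩
    intro b hb a ha
    rw [Sym2.eq_swap]
    exact hcut a ha b hb

/-- The sets obtained from `{y}` by `m` times adding a `C`-neighbour of a vertex of degree at most
`D`. -/
def grown (C : Finset (Sym2 (Fin n))) (D : ℕ) (y : Fin n) : ℕ → Finset (Finset (Fin n))
  | 0 => {{y}}
  | m + 1 => (grown C D y m).biUnion fun B =>
      ((B.filter fun v => dg C v ≤ D).biUnion fun v =>
        Finset.univ.filter fun w => s(v, w) ∈ C).image fun w => insert w B

theorem card_le_of_mem_grown {C : Finset (Sym2 (Fin n))} {D : ℕ} {y : Fin n} :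
    ∀ {m : ℕ} {B : Finset (Fin n)}, B ∈ grown C D y m → B.card ≤ m + 1
  | 0, B, h => by
      rw [grown, Finset.mem_singleton] at h
      simp [h]
  | m + 1, B, h => by
      obtain ⟨B', hB', h⟩ := Finset.mem_biUnion.1 h
      obtain ⟨w, _, rfl⟩ := Finset.mem_image.1 h
      have := card_le_of_mem_grown hB'
      have := Finset.card_insert_le w B'
      omega

theorem card_grown_le {C : Finset (Sym2 (Fin n))} {D : ℕ} {y : Fin n} {k : ℕ} :
    ∀ {m : ℕ}, m + 1 ≤ k → (grown C D y m).card ≤ (k * D) ^ m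
  | 0, _ => by simp [grown]
  | m + 1, hm => by
      rw [grown, pow_succ]
      refine (Finset.card_biUnion_le_card_mul _ _ (k * D) fun B hB => ?_).trans
        (Nat.mul_le_mul_right _ (card_grown_le (by omega)))
      refine Finset.card_image_le.trans ?_
      have hB' : B.card ≤ k := (card_le_of_mem_grown hB).trans (by omega)
      refine (Finset.card_biUnion_le_card_mul _ _ D fun v hv => ?_).trans
        (Nat.mul_le_mul_right _ ((Finset.card_filter_le _ _).trans hB'))
      refine le_trans ?_ (Finset.mem_filter.1 hv).2
      refine Finset.card_le_card_of_injOn (fun w => s(v, w)) ?_ ?_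
      · intro w hw
        simpa using hw
      · exact fun a _ b _ h => Sym2.congr_right.1 h

theorem mem_grown_of_conn {C : Finset (Sym2 (Fin n))} {D : ℕ} {y : Fin n}
    {B : Finset (Fin n)} (hB : Conn C B) (hy : y ∈ B) (hdeg : ∀ v ∈ B, dg C v ≤ D) :
    B ∈ grown C D y (B.card - 1) := by
  have chain : ∀ m, m + 1 ≤ B.card → ∃ B' ∈ grown C D y m, B' ⊆ B ∧ B'.card = m + 1 := by
    intro m
    induction m with
    | zero => exact fun _ => ⟨{y}, by simp [grown], by simpa using hy, by simp⟩
    | succ m ih =>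
        intro hm
        obtain ⟨B', hB', hsub, hc⟩ := ih (by omega)
        obtain ⟨v, hv, w, hw, hvw⟩ := hB.2 B' hsub (Finset.card_pos.1 (by omega))
          (fun h => by rw [h] at hc; omega)
        rw [Finset.mem_sdiff] at hw
        refine ⟨insert w B', ?_, Finset.insert_subset hw.1 hsub, ?_⟩
        · rw [grown]
          refine Finset.mem_biUnion.2 ⟨B', hB', Finset.mem_image.2 ⟨w, ?_, rfl⟩⟩
          exact Finset.mem_biUnion.2 ⟨v, Finset.mem_filter.2 ⟨hv, hdeg v (hsub hv)⟩,
            Finset.mem_filter.2 ⟨Finset.mem_univ _, hvw⟩⟩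
        · rw [Finset.card_insert_of_notMem hw.2, hc]
  have hpos : 1 ≤ B.card := Finset.card_pos.2 hB.1
  obtain ⟨B', hB', hsub, hc⟩ := chain (B.card - 1) (by omega)
  rwa [Finset.eq_of_subset_of_card_le hsub (by omega)] at hB'

/-- Few connected sets of given size and bounded degrees contain a given vertex. -/
theorem card_conn_le {C : Finset (Sym2 (Fin n))} {D k b : ℕ} {y : Fin n} (hb : 1 ≤ b)
    (hbk : b ≤ k) {T : Finset (Finset (Fin n))}
    (hT : ∀ B ∈ T, Conn C B ∧ y ∈ B ∧ B.card = b ∧ ∀ v ∈ B, dg C v ≤ D) :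
    T.card ≤ (k * D) ^ (b - 1) := by
  refine (Finset.card_le_card fun B hB => ?_).trans (card_grown_le (C := C) (y := y) (by omega))
  obtain ⟨h₁, h₂, h₃, h₄⟩ := hT B hB
  exact h₃ ▸ mem_grown_of_conn h₁ h₂ h₄

end Connected
/-! ### The potential of a position -/

section Weights

variable {n : ℕ}

/-- The number of edges inside `A` that do not belong to `U`. -/
def free (U : Finset (Sym2 (Fin n))) (A : Finset (Fin n)) : ℕ :=
  ((board n ∩ A.sym2) \ U).card

/-- The number of endpoints of `e` in `A`. -/
def inc (A : Finset (Fin n)) (e : Sym2 (Fin n)) : ℕ :=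
  (A.filter (· ∈ e)).card

/-- `A` is connected in Client's graph, has no edge of Waiter inside, and the number of claimed
edges at each of its vertices is at most `D`. -/
def Alive (D : ℕ) (C W : Finset (Sym2 (Fin n))) (A : Finset (Fin n)) : Prop :=
  Conn C A ∧ (∀ e ∈ W, e ∉ A.sym2) ∧ ∀ v ∈ A, dg (C ∪ W) v ≤ D

/-- The value of a set `A`: the number `1` for sets of size `k`, which cannot grow any more, and
otherwise `γ |A|` scaled by the proportion of unused degree, out of `D` for each of `k` vertices. -/
noncomputable def val (γ : ℕ → ℝ) (k D : ℕ) (U : Finset (Sym2 (Fin n))) (A : Finset (Fin n)) : ℝ :=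
  if A.card = k then 1 else γ A.card / (k * D) * ∑ v ∈ A, ((D : ℝ) - dg U v)

open Classical in
/-- The contribution of `A` to the potential: its value times the probability that a random Client
takes all edges inside `A` that are still free. -/
noncomputable def term (γ : ℕ → ℝ) (k D : ℕ) (C W : Finset (Sym2 (Fin n)))
    (A : Finset (Fin n)) : ℝ :=
  if A.card ≤ k ∧ Alive D C W A then (1 / 2) ^ free (C ∪ W) A * val γ k D (C ∪ W) A else 0

open Classical in
/-- What `A` pays for each claimed edge that meets it, when `U'` is the set of claimed edges after
the round. -/
noncomputable def fee (γ : ℕ → ℝ) (k D : ℕ) (C W U' : Finset (Sym2 (Fin n)))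
    (A : Finset (Fin n)) : ℝ :=
  if A.card < k ∧ Alive D C W A ∧ ∀ v ∈ A, dg U' v ≤ D then
    (1 / 2) ^ free (C ∪ W) A * (γ A.card / (k * D)) else 0

/-- The potential: the sum of the contributions of all vertex sets. -/
noncomputable def potential (γ : ℕ → ℝ) (k D : ℕ) (C W : Finset (Sym2 (Fin n))) : ℝ :=
  ∑ A : Finset (Fin n), term γ k D C W A

variable {γ : ℕ → ℝ} {k D : ℕ}

theorem val_nonneg (hγ : ∀ a, 0 ≤ γ a) {U : Finset (Sym2 (Fin n))} {A : Finset (Fin n)}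
    (h : ∀ v ∈ A, dg U v ≤ D) : 0 ≤ val γ k D U A := by
  rw [val]
  split_ifs
  · exact zero_le_one
  · refine mul_nonneg (div_nonneg (hγ _) (by positivity)) (Finset.sum_nonneg fun v hv => ?_)
    rw [sub_nonneg]
    exact_mod_cast h v hv

theorem val_le (hγ : ∀ a, 0 ≤ γ a) (hγk : γ k = 1) {U : Finset (Sym2 (Fin n))}
    {A : Finset (Fin n)} (hA : A.card ≤ k) : val γ k D U A ≤ γ A.card := by
  rw [val]
  split_ifs with h
  · rw [h, hγk]
  · have hs : ∑ v ∈ A, ((D : ℝ) - dg U v) ≤ k * D := by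
      calc ∑ v ∈ A, ((D : ℝ) - dg U v) ≤ ∑ _v ∈ A, (D : ℝ) :=
            Finset.sum_le_sum fun v _ => by
              have : (0 : ℝ) ≤ dg U v := Nat.cast_nonneg _
              linarith
        _ = A.card * D := by rw [Finset.sum_const, nsmul_eq_mul]
        _ ≤ k * D := by
            have : (A.card : ℝ) ≤ k := by exact_mod_cast hA
            gcongr
    rw [div_mul_eq_mul_div]
    exact div_le_of_le_mul₀ (by positivity) (hγ _) (mul_le_mul_of_nonneg_left hs (hγ _))

theorem term_nonneg (hγ : ∀ a, 0 ≤ γ a) (C W : Finset (Sym2 (Fin n))) (A : Finset (Fin n)) :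
    0 ≤ term γ k D C W A := by
  rw [term]
  split_ifs with h
  · exact mul_nonneg (by positivity) (val_nonneg hγ h.2.2.2)
  · exact le_rfl

theorem fee_nonneg (hγ : ∀ a, 0 ≤ γ a) (C W U' : Finset (Sym2 (Fin n))) (A : Finset (Fin n)) :
    0 ≤ fee γ k D C W U' A := by
  rw [fee]
  split_ifs
  · exact mul_nonneg (by positivity) (div_nonneg (hγ _) (by positivity))
  · exact le_rfl

theorem dg_insert {U : Finset (Sym2 (Fin n))} {e : Sym2 (Fin n)} (he : e ∉ U) (v : Fin n) :
    dg (insert e U) v = dg U v + if v ∈ e then 1 else 0 := by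
  rw [dg, Finset.filter_insert]
  split_ifs
  · rw [Finset.card_insert_of_notMem fun h => he (Finset.mem_filter.1 h).1, dg]
  · rfl

theorem sum_slots_insert {U : Finset (Sym2 (Fin n))} {e : Sym2 (Fin n)} (he : e ∉ U)
    (A : Finset (Fin n)) :
    ∑ v ∈ A, ((D : ℝ) - dg (insert e U) v) = ∑ v ∈ A, ((D : ℝ) - dg U v) - inc A e := by
  have : (inc A e : ℝ) = ∑ v ∈ A, if v ∈ e then (1 : ℝ) else 0 := by
    rw [inc, Finset.sum_boole]
  rw [this, ← Finset.sum_sub_distrib]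
  refine Finset.sum_congr rfl fun v _ => ?_
  rw [dg_insert he]
  push_cast
  ring

theorem free_insert {U : Finset (Sym2 (Fin n))} {e : Sym2 (Fin n)} (he : e ∉ U)
    (heb : e ∈ board n) (A : Finset (Fin n)) :
    free U A = free (insert e U) A + if e ∈ A.sym2 then 1 else 0 := by
  rw [free, free, Finset.sdiff_insert]
  split_ifs with h
  · rw [Finset.card_erase_add_one]
    simp [h, heb, he]
  · rw [Finset.erase_eq_of_notMem, add_zero]
    simp [h]

theorem insert_union_insert (C W : Finset (Sym2 (Fin n))) (e f : Sym2 (Fin n)) :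
    insert e C ∪ insert f W = insert e (insert f (C ∪ W)) := by
  ext z
  simp only [Finset.mem_union, Finset.mem_insert]
  tauto

/-- In one round, a set that is already connected loses on average the fees for the offered
edges that meet it. -/
theorem term_add_term_le (hγ : ∀ a, 0 ≤ γ a) {C W : Finset (Sym2 (Fin n))}
    {e f : Sym2 (Fin n)} (he : e ∉ C ∪ W) (hf : f ∉ C ∪ W) (hef : e ≠ f) (heb : e ∈ board n)
    (hfb : f ∈ board n) {A : Finset (Fin n)} (hA : Conn C A) :
    term γ k D (insert e C) (insert f W) A + term γ k D (insert f C) (insert e W) A +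
      2 * (fee γ k D C W (insert e (insert f (C ∪ W))) A * (inc A e + inc A f)) ≤
      2 * term γ k D C W A := by
  set U := C ∪ W with hU
  set U' := insert e (insert f U) with hU'
  have hU₁ : insert e C ∪ insert f W = U' := insert_union_insert _ _ _ _
  have hU₂ : insert f C ∪ insert e W = U' := by
    rw [insert_union_insert, Finset.insert_comm]
  have hef' : e ∉ insert f U := by simp [hef, he]
  by_cases hgood : A.card ≤ k ∧ (∀ w ∈ W, w ∉ A.sym2) ∧ ∀ v ∈ A, dg U' v ≤ D
  · obtain ⟨hAk, hW, hdeg⟩ := hgood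
    have hUU' : U ⊆ U' := (Finset.subset_insert _ _).trans (Finset.subset_insert _ _)
    have halive : Alive D C W A := ⟨hA, hW, fun v hv => (dg_mono hUU' v).trans (hdeg v hv)⟩
    have hv := val_nonneg (k := k) hγ hdeg
    have hfree : free U A = free U' A + (if e ∈ A.sym2 then 1 else 0) +
        if f ∈ A.sym2 then 1 else 0 := by
      rw [free_insert hf hfb, free_insert hef' heb]
    have hval : val γ k D U' A * (1 / 2) ^ free U A +
        fee γ k D C W U' A * (inc A e + inc A f) = val γ k D U A * (1 / 2) ^ free U A := by
      rw [val, val, fee]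
      by_cases hk : A.card = k
      · simp [hk]
      · rw [if_neg hk, if_neg hk, if_pos ⟨lt_of_le_of_ne hAk hk, halive, hdeg⟩, hU',
          sum_slots_insert hef', sum_slots_insert hf]
        ring
    -- The new weights of `A` after the two answers add up to at most twice the old one.
    have hnew : ∀ a b, insert a C ∪ insert b W = U' →
        term γ k D (insert a C) (insert b W) A =
          if b ∈ A.sym2 then 0 else (1 / 2) ^ free U' A * val γ k D U' A := by
      intro a b hab
      rw [term, hab]
      by_cases hb : b ∈ A.sym2
      · rw [if_pos hb, if_neg]
        exact fun h => h.2.2.1 b (Finset.mem_insert_self _ _) hb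
      · rw [if_neg hb, if_pos]
        refine ⟨hAk, hA.mono (Finset.subset_insert _ _), fun w hw => ?_, by rwa [hab]⟩
        rcases Finset.mem_insert.1 hw with rfl | hw
        · exact hb
        · exact hW w hw
    have hsum : term γ k D (insert e C) (insert f W) A + term γ k D (insert f C) (insert e W) A ≤
        2 * (val γ k D U' A * (1 / 2) ^ free U A) := by
      rw [hnew e f hU₁, hnew f e hU₂, hfree]
      have hp : (0 : ℝ) ≤ (1 / 2) ^ free U' A * val γ k D U' A := by positivity
      split_ifs <;> simp only [add_zero, pow_succ] <;> nlinarith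
    have hold : term γ k D C W A = val γ k D U A * (1 / 2) ^ free U A := by
      rw [term, if_pos ⟨hAk, halive⟩, mul_comm]
    rw [hold, ← hval]
    linarith
  · have h₁ : term γ k D (insert e C) (insert f W) A = 0 := by
      rw [term, if_neg]
      rintro ⟨hk, h⟩
      exact hgood ⟨hk, fun w hw => h.2.1 w (Finset.mem_insert_of_mem hw), hU₁ ▸ h.2.2⟩
    have h₂ : term γ k D (insert f C) (insert e W) A = 0 := by
      rw [term, if_neg]
      rintro ⟨hk, h⟩
      exact hgood ⟨hk, fun w hw => h.2.1 w (Finset.mem_insert_of_mem hw), hU₂ ▸ h.2.2⟩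
    have h₃ : fee γ k D C W U' A = 0 := by
      rw [fee, if_neg]
      rintro ⟨hk, h, h'⟩
      exact hgood ⟨hk.le, h.2.1, h'⟩
    rw [h₁, h₂, h₃]
    linarith [term_nonneg (k := k) (D := D) hγ C W A]

/-- A set born by joining `A` and `B` with the edge `e` has all other edges between `A` and `B`
still free. -/
theorem free_add_le {C W : Finset (Sym2 (Fin n))} {e f : Sym2 (Fin n)} {A B : Finset (Fin n)}
    (hAB : Disjoint A B) (hcut : ∀ a ∈ A, ∀ b ∈ B, s(a, b) ∉ C)
    (hW : ∀ w ∈ insert f W, w ∉ (A ∪ B).sym2) :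
    free (C ∪ W) A + A.card * B.card ≤ free (insert e (insert f (C ∪ W))) (A ∪ B) + 1 := by
  have hABne : ∀ a ∈ A, ∀ b ∈ B, a ≠ b := fun a ha b hb h => Finset.disjoint_left.1 hAB ha (h ▸ hb)
  have hcross : ((A ×ˢ B).image fun p : Fin n × Fin n => s(p.1, p.2)).card = A.card * B.card := by
    rw [Finset.card_image_of_injOn, Finset.card_product]
    rintro ⟨a, b⟩ hab ⟨a', b'⟩ hab' h
    have h₁ := Finset.mem_product.1 hab
    have h₂ := Finset.mem_product.1 hab'
    rcases Sym2.eq_iff.1 h with ⟨h, h'⟩ | ⟨h, h'⟩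
    · exact Prod.ext h h'
    · exact absurd h (hABne _ h₁.1 _ h₂.2)
  have hdisj : Disjoint ((board n ∩ A.sym2) \ (C ∪ W))
      ((A ×ˢ B).image fun p : Fin n × Fin n => s(p.1, p.2)) := by
    rw [Finset.disjoint_left]
    intro z hz hz'
    obtain ⟨⟨a, b⟩, hab, rfl⟩ := Finset.mem_image.1 hz'
    have h₁ := Finset.mem_product.1 hab
    have h₂ := (Finset.mem_inter.1 (Finset.mem_sdiff.1 hz).1).2
    exact hABne b (Finset.mk_mem_sym2_iff.1 h₂).2 b h₁.2 rfl
  rw [free, ← hcross, ← Finset.card_union_of_disjoint hdisj, free]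
  refine le_trans (Finset.card_le_card (t := insert e ((board n ∩ (A ∪ B).sym2) \
    insert e (insert f (C ∪ W)))) ?_) (Finset.card_insert_le _ _)
  intro z hz
  by_cases hze : z = e
  · exact hze ▸ Finset.mem_insert_self _ _
  refine Finset.mem_insert_of_mem ?_
  have hzK : z ∈ board n ∧ z ∈ (A ∪ B).sym2 ∧ z ∉ C := by
    rcases Finset.mem_union.1 hz with hz | hz
    · rw [Finset.mem_sdiff, Finset.mem_inter, Finset.mem_union, not_or] at hz
      exact ⟨hz.1.1, Finset.sym2_mono Finset.subset_union_left hz.1.2, hz.2.1⟩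
    · obtain ⟨⟨a, b⟩, hab, rfl⟩ := Finset.mem_image.1 hz
      obtain ⟨ha, hb⟩ := Finset.mem_product.1 hab
      exact ⟨mk_mem_board.2 (hABne a ha b hb), Finset.mk_mem_sym2_iff.2
        ⟨Finset.mem_union_left _ ha, Finset.mem_union_right _ hb⟩, hcut a ha b hb⟩
  have hzW : z ∉ insert f W := fun h => hW z h hzK.2.1
  simp only [Finset.mem_sdiff, Finset.mem_inter, Finset.mem_insert, Finset.mem_union] at hzW ⊢
  tauto

end Weights
section Step

theorem sum_le_sum_of_cover {ι κ : Type*} [DecidableEq ι] {s : Finset ι} {t : Finset κ}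
    {g : ι → ℝ} {h : κ → ℝ} (r : κ → ι) (hh : ∀ p ∈ t, 0 ≤ h p)
    (hcover : ∀ i ∈ s, g i ≠ 0 → ∃ p ∈ t, r p = i ∧ g i ≤ h p) :
    ∑ i ∈ s, g i ≤ ∑ p ∈ t, h p := by
  have hnn : ∀ i, ∀ p ∈ t.filter (fun p => r p = i), 0 ≤ h p := fun i p hp =>
    hh p (Finset.mem_filter.1 hp).1
  calc ∑ i ∈ s, g i ≤ ∑ i ∈ s, ∑ p ∈ t.filter (fun p => r p = i), h p := by
        refine Finset.sum_le_sum fun i hi => ?_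
        by_cases hg : g i = 0
        · rw [hg]
          exact Finset.sum_nonneg (hnn i)
        · obtain ⟨p, hp, hpi, hle⟩ := hcover i hi hg
          exact hle.trans (Finset.single_le_sum (hnn i) (Finset.mem_filter.2 ⟨hp, hpi⟩))
    _ ≤ ∑ p ∈ t, h p :=
        Finset.sum_fiberwise_le_sum_of_sum_fiber_nonneg fun i _ => Finset.sum_nonneg (hnn i)

variable {n : ℕ} {γ : ℕ → ℝ} {k D : ℕ}

theorem inc_mk (A : Finset (Fin n)) {x y : Fin n} (hxy : x ≠ y) :
    inc A s(x, y) = (if x ∈ A then 1 else 0) + if y ∈ A then 1 else 0 := by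
  simp only [inc, Sym2.mem_iff]
  rw [Finset.filter_or, Finset.card_union_of_disjoint, Finset.filter_eq', Finset.filter_eq']
  · congr 1 <;> split_ifs <;> rfl
  · rw [Finset.disjoint_filter]
    rintro z _ rfl h
    exact hxy h

open Classical in
/-- Any set that becomes connected in the round is paid for by the fees of the larger of the two
sets it is joined from. -/
theorem sum_newborn_le (hγ : ∀ a, 0 ≤ γ a) (hγk : γ k = 1) (hkD : 0 < k * D)
    (hrec : ∀ a, 1 ≤ a → a < k → ∑ b ∈ Finset.Icc 1 (min a (k - a)),
      ((k : ℝ) * D) ^ b * (1 / 2) ^ (a * b) * γ (a + b) ≤ γ a)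
    {C W : Finset (Sym2 (Fin n))} {e f : Sym2 (Fin n)} (heb : e ∈ board n) :
    ∑ K : Finset (Fin n) with ¬ Conn C K, term γ k D (insert e C) (insert f W) K ≤
      2 * ∑ A : Finset (Fin n), fee γ k D C W (insert e (insert f (C ∪ W))) A * inc A e := by
  induction e using Sym2.ind with
  | _ x y =>
  have hxy : x ≠ y := mk_mem_board.1 heb
  set U := C ∪ W with hU
  set U' := insert s(x, y) (insert f U) with hU'
  have hU₁ : insert s(x, y) C ∪ insert f W = U' := insert_union_insert _ _ _ _
  have hUU' : U ⊆ U' := (Finset.subset_insert _ _).trans (Finset.subset_insert _ _)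
  have hCU' : C ⊆ U' := Finset.subset_union_left.trans hUU'
  have hk0 : (k : ℝ) ≠ 0 := by exact_mod_cast (Nat.pos_of_mul_pos_right hkD).ne'
  have hD0 : (D : ℝ) ≠ 0 := by exact_mod_cast (Nat.pos_of_mul_pos_left hkD).ne'
  let G : Finset (Finset (Fin n)) := Finset.univ.filter fun A =>
    A.card < k ∧ Alive D C W A ∧ ∀ v ∈ A, dg U' v ≤ D
  let P : Finset (Fin n) → Finset (Finset (Fin n)) := fun A => Finset.univ.filter fun B =>
    B.card ≤ A.card ∧ A.card + B.card ≤ k ∧ (Conn C B ∧ ∀ v ∈ B, dg C v ≤ D) ∧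
      ((x ∈ A ∧ y ∈ B) ∨ (y ∈ A ∧ x ∈ B))
  let h : Finset (Fin n) → ℕ → ℝ := fun A b =>
    2 * ((1 / 2) ^ free U A * ((1 / 2) ^ (A.card * b) * γ (A.card + b)))
  have hh : ∀ A b, 0 ≤ h A b := fun A b => by
    have := hγ (A.card + b)
    positivity
  have hcover : ∑ K : Finset (Fin n) with ¬ Conn C K, term γ k D (insert s(x, y) C) (insert f W) K ≤
      ∑ p ∈ G.sigma P, h p.1 p.2.card := by
    refine sum_le_sum_of_cover (fun p => p.1 ∪ p.2) (fun p _ => hh _ _) fun K hK hne => ?_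
    rw [Finset.mem_filter] at hK
    have hK' : K.card ≤ k ∧ Alive D (insert s(x, y) C) (insert f W) K := by
      by_contra hcon
      exact hne (by rw [term, if_neg hcon])
    obtain ⟨hKk, hKc, hKW, hKdeg⟩ := hK'
    obtain ⟨A, B, hAB, rfl, hA, hB, hle, hcut, hor⟩ := hKc.exists_split hK.2
    rw [hU₁] at hKdeg
    have hcard := Finset.card_union_of_disjoint hAB
    have hBpos : 1 ≤ B.card := Finset.card_pos.2 hB.1
    have hABk : A.card + B.card ≤ k := hcard ▸ hKk
    have hAk : A.card < k := by omega
    refine ⟨⟨A, B⟩, Finset.mem_sigma.2 ⟨Finset.mem_filter.2 ⟨Finset.mem_univ _, hAk,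
      ⟨hA, fun w hw hwA => hKW w (Finset.mem_insert_of_mem hw)
        (Finset.sym2_mono Finset.subset_union_left hwA), fun v hv =>
        (dg_mono hUU' v).trans (hKdeg v (Finset.mem_union_left _ hv))⟩,
        fun v hv => hKdeg v (Finset.mem_union_left _ hv)⟩,
      Finset.mem_filter.2 ⟨Finset.mem_univ _, hle, hABk, ⟨hB, fun v hv =>
        (dg_mono hCU' v).trans (hKdeg v (Finset.mem_union_right _ hv))⟩, hor⟩⟩, rfl, ?_⟩
    rw [term, if_pos ⟨hKk, hKc, hKW, by rwa [hU₁]⟩, hU₁]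
    have hfree := free_add_le (e := s(x, y)) hAB hcut hKW
    calc (1 / 2) ^ free U' (A ∪ B) * val γ k D U' (A ∪ B)
        ≤ (1 / 2) ^ free U' (A ∪ B) * γ (A ∪ B).card := by
          gcongr
          exact val_le hγ hγk hKk
      _ = 2 * ((1 / 2) ^ (free U' (A ∪ B) + 1) * γ (A.card + B.card)) := by
          rw [hcard, pow_succ]
          ring
      _ ≤ 2 * ((1 / 2) ^ (free U A + A.card * B.card) * γ (A.card + B.card)) := by
          gcongr 2 * (?_ * _)
          · exact hγ _
          · exact pow_le_pow_of_le_one (by norm_num) (by norm_num) hfree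
      _ = h A B.card := by
          rw [pow_add, mul_assoc]
  refine hcover.trans ?_
  rw [Finset.sum_sigma, Finset.mul_sum]
  refine le_trans (Finset.sum_le_sum fun A hA => ?_)
    (Finset.sum_le_sum_of_subset_of_nonneg (Finset.subset_univ G) fun A _ _ =>
      mul_nonneg zero_le_two (mul_nonneg (fee_nonneg hγ _ _ _ _) (Nat.cast_nonneg _)))
  have hA' := (Finset.mem_filter.1 hA).2
  have hA₁ : 1 ≤ A.card := Finset.card_pos.2 hA'.2.1.1.1
  have hmaps : ∀ B ∈ P A, B.card ∈ Finset.Icc 1 (min A.card (k - A.card)) := by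
    intro B hB
    obtain ⟨_, h₁, h₂, h₃, _⟩ := Finset.mem_filter.1 hB
    have := Finset.card_pos.2 h₃.1.1
    rw [Finset.mem_Icc, le_min_iff]
    omega
  have hcount : ∀ b ∈ Finset.Icc 1 (min A.card (k - A.card)),
      ((P A).filter fun B => B.card = b).card ≤ inc A s(x, y) * (k * D) ^ (b - 1) := by
    intro b hb
    rw [Finset.mem_Icc, le_min_iff] at hb
    have hone : ∀ z w : Fin n, ((P A).filter fun B => B.card = b ∧ z ∈ A ∧ w ∈ B).card ≤
        (if z ∈ A then 1 else 0) * (k * D) ^ (b - 1) := by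
      intro z w
      split_ifs with hz
      · rw [one_mul]
        refine card_conn_le (C := C) (y := w) hb.1 (by omega) fun B hB => ?_
        obtain ⟨h₁, h₂, _, h₃⟩ := Finset.mem_filter.1 hB
        obtain ⟨_, _, _, h₄, _⟩ := Finset.mem_filter.1 h₁
        exact ⟨h₄.1, h₃, h₂, h₄.2⟩
      · simp [hz]
    rw [inc_mk A hxy, add_mul]
    refine le_trans ?_ (add_le_add (hone x y) (hone y x))
    refine le_trans (Finset.card_le_card fun B hB => ?_) (Finset.card_union_le _ _)
    obtain ⟨h₁, h₂⟩ := Finset.mem_filter.1 hB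
    obtain ⟨_, _, _, _, h₃⟩ := Finset.mem_filter.1 h₁
    exact Finset.mem_union.2 (h₃.imp (fun h => Finset.mem_filter.2 ⟨h₁, h₂, h⟩)
      fun h => Finset.mem_filter.2 ⟨h₁, h₂, h⟩)
  rw [← Finset.sum_fiberwise_of_maps_to hmaps]
  calc ∑ b ∈ Finset.Icc 1 (min A.card (k - A.card)), ∑ B ∈ P A with B.card = b, h A B.card
      ≤ ∑ b ∈ Finset.Icc 1 (min A.card (k - A.card)),
          (inc A s(x, y) * ((k : ℝ) * D) ^ (b - 1)) * h A b := by
        refine Finset.sum_le_sum fun b hb => ?_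
        rw [Finset.sum_congr rfl fun B hB => by rw [(Finset.mem_filter.1 hB).2],
          Finset.sum_const, nsmul_eq_mul]
        refine mul_le_mul_of_nonneg_right ?_ (hh A b)
        exact_mod_cast hcount b hb
    _ = 2 * inc A s(x, y) * (1 / 2) ^ free U A / (k * D) *
          ∑ b ∈ Finset.Icc 1 (min A.card (k - A.card)),
            ((k : ℝ) * D) ^ b * (1 / 2) ^ (A.card * b) * γ (A.card + b) := by
        rw [Finset.mul_sum]
        refine Finset.sum_congr rfl fun b hb => ?_
        obtain ⟨c, rfl⟩ := Nat.exists_eq_add_of_le' (Finset.mem_Icc.1 hb).1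
        simp only [h, Nat.add_sub_cancel]
        rw [pow_succ ((k : ℝ) * D) c]
        field_simp
    _ ≤ 2 * inc A s(x, y) * (1 / 2) ^ free U A / (k * D) * γ A.card := by
        gcongr
        exact hrec _ hA₁ hA'.1
    _ = 2 * (fee γ k D C W U' A * inc A s(x, y)) := by
        rw [fee, if_pos hA']
        ring

/-- The potential does not grow on average. -/
theorem potential_step (hγ : ∀ a, 0 ≤ γ a) (hγk : γ k = 1) (hkD : 0 < k * D)
    (hrec : ∀ a, 1 ≤ a → a < k → ∑ b ∈ Finset.Icc 1 (min a (k - a)),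
      ((k : ℝ) * D) ^ b * (1 / 2) ^ (a * b) * γ (a + b) ≤ γ a)
    {C W : Finset (Sym2 (Fin n))} {e f : Sym2 (Fin n)} (he : e ∈ board n \ (C ∪ W))
    (hf : f ∈ board n \ (C ∪ W)) (hef : e ≠ f) :
    potential γ k D (insert e C) (insert f W) + potential γ k D (insert f C) (insert e W) ≤
      2 * potential γ k D C W := by
  classical
  rw [Finset.mem_sdiff] at he hf
  set U' := insert e (insert f (C ∪ W)) with hU'
  have h₁ := sum_newborn_le (f := f) (W := W) hγ hγk hkD hrec (C := C) he.1
  have h₂ := sum_newborn_le (f := e) (W := W) hγ hγk hkD hrec (C := C) hf.1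
  rw [← hU'] at h₁
  rw [Finset.insert_comm, ← hU'] at h₂
  have hfee : ∀ g : Sym2 (Fin n), ∑ A : Finset (Fin n), fee γ k D C W U' A * inc A g =
      ∑ A : Finset (Fin n) with Conn C A, fee γ k D C W U' A * inc A g := by
    intro g
    rw [Finset.sum_filter_of_ne]
    intro A _ hne
    by_contra hA
    exact hne (by rw [fee, if_neg fun h => hA h.2.1.1, zero_mul])
  rw [hfee] at h₁ h₂
  have hold : ∑ A : Finset (Fin n) with Conn C A, (term γ k D (insert e C) (insert f W) A +
      term γ k D (insert f C) (insert e W) A +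
      2 * (fee γ k D C W U' A * (inc A e + inc A f))) ≤
      ∑ A : Finset (Fin n) with Conn C A, 2 * term γ k D C W A :=
    Finset.sum_le_sum fun A hA =>
      term_add_term_le hγ he.2 hf.2 hef he.1 hf.1 (Finset.mem_filter.1 hA).2
  have hle : ∑ A : Finset (Fin n) with Conn C A, term γ k D C W A ≤ potential γ k D C W :=
    Finset.sum_le_sum_of_subset_of_nonneg (Finset.filter_subset _ _) fun A _ _ =>
      term_nonneg hγ C W A
  simp only [Finset.sum_add_distrib, ← Finset.mul_sum, mul_add] at hold
  rw [potential, potential, ← Finset.sum_filter_add_sum_filter_not Finset.univ (Conn C)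
    (fun A => term γ k D (insert e C) (insert f W) A),
    ← Finset.sum_filter_add_sum_filter_not Finset.univ (Conn C)
    (fun A => term γ k D (insert f C) (insert e W) A)]
  linarith

end Step
/-! ### The lower bound -/

section LowerBound

variable {n k : ℕ}

theorem sum_dg_le {U : Finset (Sym2 (Fin n))} (hU : U ⊆ board n) :
    ∑ v, dg U v ≤ 2 * U.card := by
  have h := Finset.sum_card_bipartiteAbove_eq_sum_card_bipartiteBelow
    (s := (Finset.univ : Finset (Fin n))) (t := U) (fun v e => v ∈ e)
  have hd : ∑ v, dg U v = ∑ e ∈ U, inc Finset.univ e := h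
  rw [hd, mul_comm]
  refine Finset.sum_le_card_nsmul _ _ 2 fun e he => ?_
  have heb := hU he
  induction e using Sym2.ind with
  | _ x y => rw [inc_mk _ (mk_mem_board.1 heb)]; simp

theorem cliqueIn_of_mem_parts {C F : Finset (Sym2 (Fin n))}
    {P : Finpartition (Finset.univ : Finset (Fin n))} (hFC : F ⊆ C)
    (hF : ∀ e, e ∈ F ↔ e ∈ board n ∧ ∃ p ∈ P.parts, ∀ v ∈ e, v ∈ p) {p : Finset (Fin n)}
    (hp : p ∈ P.parts) : CliqueIn C p := by
  intro a ha b hb hab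
  refine hFC ((hF _).2 ⟨mk_mem_board.2 hab, p, hp, fun v hv => ?_⟩)
  rcases Sym2.mem_iff.1 hv with rfl | rfl
  · exact ha
  · exact hb

/-- Client's graph must have an edge at every vertex. -/
theorem ForcesWithin.le_two_mul (hk : 2 ≤ k) {t : ℕ}
    (h : ForcesWithin (board n) 1 (cliqueFactors n k) t ∅ ∅) : n ≤ 2 * t := by
  obtain ⟨C, W, -, hCX, hCt, -, -, F, ⟨P, hPk, hF⟩, hFC⟩ :=
    h.exists_final (Φ := fun _ _ => 0) (by simp) t ∅ ∅ (by simp) (by simp)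
  have hpos : ∀ v : Fin n, 1 ≤ dg C v := by
    intro v
    obtain ⟨p, hp, hv⟩ := P.exists_mem (Finset.mem_univ v)
    obtain ⟨w, hw, hwv⟩ := Finset.exists_mem_ne (by rw [hPk p hp]; omega) v
    exact Finset.card_pos.2 ⟨s(v, w), Finset.mem_filter.2
      ⟨cliqueIn_of_mem_parts hFC hF hp v hv w hw hwv.symm, by simp⟩⟩
  have h₁ := sum_dg_le (Finset.subset_union_left.trans hCX : C ⊆ board n)
  have h₂ : ∑ _v : Fin n, 1 ≤ ∑ v, dg C v := Finset.sum_le_sum fun v _ => hpos v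
  simp only [Finset.sum_const, Finset.card_univ, Fintype.card_fin, smul_eq_mul, mul_one] at h₂
  rw [Finset.card_empty] at hCt
  omega

theorem potential_empty_le {γ : ℕ → ℝ} {D : ℕ} (hγ : ∀ a, 0 ≤ γ a) (hγk : γ k = 1) (hk : 1 ≤ k) :
    potential γ k D (∅ : Finset (Sym2 (Fin n))) ∅ ≤ n * γ 1 := by
  have h : potential γ k D (∅ : Finset (Sym2 (Fin n))) ∅ ≤ ∑ _v : Fin n, γ 1 := by
    refine sum_le_sum_of_cover (fun v => {v}) (fun _ _ => hγ 1) fun A _ hA => ?_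
    have hA' : A.card ≤ k ∧ Alive D ∅ ∅ A := by
      by_contra hcon
      exact hA (by rw [term, if_neg hcon])
    obtain ⟨v, hv⟩ := hA'.2.1.1
    have hAv : {v} = A := by
      by_contra hne
      obtain ⟨x, _, y, _, hxy⟩ := hA'.2.1.2 {v} (by simpa using hv) (by simp) hne
      simp at hxy
    refine ⟨v, Finset.mem_univ _, hAv, ?_⟩
    rw [term, if_pos hA', ← hAv]
    have hc : ({v} : Finset (Fin n)).card = 1 := rfl
    have hle := val_le (D := D) (U := ∅ ∪ ∅) (A := {v}) hγ hγk (by rw [hc]; exact hk)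
    rw [hc] at hle
    have h0 := val_nonneg (k := k) (γ := γ) hγ (hAv ▸ hA'.2.2.2)
    exact (mul_le_of_le_one_left h0 (pow_le_one₀ (by norm_num) (by norm_num))).trans hle
  simpa using h

/-- If Waiter forces a `K_k`-factor within `t` rounds, then all but `4 * t / (D + 1)` of its
cliques have degrees at most `D`, and the potential bounds the number of such cliques. -/
theorem ForcesWithin.le_potential (hk : 1 ≤ k) {t D : ℕ} {γ : ℕ → ℝ} (hγ : ∀ a, 0 ≤ γ a)
    (hγk : γ k = 1) (hD : 0 < D)
    (hrec : ∀ a, 1 ≤ a → a < k → ∑ b ∈ Finset.Icc 1 (min a (k - a)),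
      ((k : ℝ) * D) ^ b * (1 / 2) ^ (a * b) * γ (a + b) ≤ γ a)
    (h : ForcesWithin (board n) 1 (cliqueFactors n k) t ∅ ∅) :
    (n : ℝ) / k ≤ n * γ 1 + 4 * t / (D + 1) := by
  classical
  obtain ⟨C, W, hdisj, hX, hCt, hWt, hΦ, F, ⟨P, hPk, hF⟩, hFC⟩ :=
    h.exists_final (Φ := potential γ k D)
      (fun C W e f _ _ he hf hef => potential_step hγ hγk (Nat.mul_pos hk hD) hrec he hf hef)
      t ∅ ∅ (by simp) (by simp)
  rw [Finset.card_empty, Nat.zero_add] at hCt hWt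
  have hclique := fun p (hp : p ∈ P.parts) => cliqueIn_of_mem_parts hFC hF hp
  set U := C ∪ W with hU
  have hsplit := Finset.card_filter_add_card_filter_not (s := P.parts)
    (fun p => ∀ v ∈ p, dg U v ≤ D)
  have hparts : P.parts.card * k = n := by
    have := P.sum_card_parts
    rw [Finset.sum_const_nat hPk, Finset.card_univ, Fintype.card_fin] at this
    exact this
  have hgood : ((P.parts.filter fun p => ∀ v ∈ p, dg U v ≤ D).card : ℝ) ≤ n * γ 1 := by
    refine le_trans ?_ (hΦ.trans (potential_empty_le hγ hγk hk))
    have hone : ∀ p ∈ P.parts.filter fun p => ∀ v ∈ p, dg U v ≤ D, term γ k D C W p = 1 := by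
      intro p hp
      obtain ⟨hp, hdeg⟩ := Finset.mem_filter.1 hp
      have hinside : ∀ e ∈ board n, e ∈ p.sym2 → e ∈ C := by
        intro e heb he
        induction e using Sym2.ind with
        | _ a b =>
          exact hclique p hp a (Finset.mk_mem_sym2_iff.1 he).1 b (Finset.mk_mem_sym2_iff.1 he).2
            (mk_mem_board.1 heb)
      have hfree : free (C ∪ W) p = 0 := by
        rw [free, Finset.card_eq_zero, Finset.sdiff_eq_empty_iff_subset]
        intro e he
        exact Finset.mem_union_left _ (hinside e (Finset.mem_inter.1 he).1 (Finset.mem_inter.1 he).2)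
      rw [term, if_pos, hfree, val, if_pos (hPk p hp)]
      · norm_num
      · refine ⟨(hPk p hp).le, (hclique p hp).conn (P.nonempty_of_mem_parts hp), ?_, hdeg⟩
        exact fun e he hep => Finset.disjoint_left.1 hdisj
          (hinside e (hX (Finset.mem_union_right _ he)) hep) he
    calc ((P.parts.filter fun p => ∀ v ∈ p, dg U v ≤ D).card : ℝ)
        = ∑ p ∈ P.parts.filter fun p => ∀ v ∈ p, dg U v ≤ D, term γ k D C W p := by
          rw [Finset.sum_congr rfl hone]
          simp
      _ ≤ potential γ k D C W :=
          Finset.sum_le_sum_of_subset_of_nonneg (Finset.subset_univ _) fun A _ _ =>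
            term_nonneg hγ C W A
  have hbad : (P.parts.filter fun p => ¬ ∀ v ∈ p, dg U v ≤ D).card * (D + 1) ≤ 4 * t := by
    have hle : (P.parts.filter fun p => ¬ ∀ v ∈ p, dg U v ≤ D).card ≤
        (Finset.univ.filter fun v => D < dg U v).card := by
      refine Finset.card_le_card_of_surjOn P.part ?_
      intro p hp
      obtain ⟨hp, hv⟩ := Finset.mem_filter.1 hp
      push Not at hv
      obtain ⟨v, hv, hvD⟩ := hv
      exact ⟨v, by simpa using hvD, P.part_eq_of_mem hp hv⟩
    have hsum : (Finset.univ.filter fun v => D < dg U v).card * (D + 1) ≤ ∑ v, dg U v := by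
      have h₁ : (Finset.univ.filter fun v => D < dg U v).card * (D + 1) ≤
          ∑ v with D < dg U v, dg U v :=
        Finset.card_nsmul_le_sum (Finset.univ.filter fun v => D < dg U v) (dg U) (D + 1)
          fun v hv => (Finset.mem_filter.1 hv).2
      exact h₁.trans (Finset.sum_le_sum_of_subset (Finset.filter_subset _ _))
    have h₁ := sum_dg_le hX
    have h₂ := Finset.card_union_le C W
    rw [← hU] at h₂
    calc _ ≤ _ := Nat.mul_le_mul_right _ hle
      _ ≤ _ := hsum
      _ ≤ _ := h₁
      _ ≤ 4 * t := by omega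
  have hbad' : ((P.parts.filter fun p => ¬ ∀ v ∈ p, dg U v ≤ D).card : ℝ) ≤ 4 * t / (D + 1) := by
    rw [le_div_iff₀ (by positivity)]
    exact_mod_cast hbad
  have hnk : (n : ℝ) / k = P.parts.card := by
    rw [div_eq_iff (by positivity)]
    exact_mod_cast hparts.symm
  have hsplit' : ((P.parts.filter fun p => ∀ v ∈ p, dg U v ≤ D).card : ℝ) +
      (P.parts.filter fun p => ¬ ∀ v ∈ p, dg U v ≤ D).card = P.parts.card := by
    exact_mod_cast hsplit
  rw [hnk]
  linarith

/-- The weight of a connected set of size `m`: the factor `2 ^ (-(k ^ 2 - m ^ 2) / 3)` reflects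
that growing to size `k` by joining a smaller set to a larger one needs at least
`(k ^ 2 - m ^ 2) / 3` further edges between the joined sets. -/
noncomputable def growthWeight (k : ℕ) (M : ℝ) (m : ℕ) : ℝ :=
  M ^ (k - m) * (2 : ℝ) ^ (-((k : ℝ) ^ 2 - (m : ℝ) ^ 2) / 3)

theorem growthWeight_self (k : ℕ) (M : ℝ) : growthWeight k M k = 1 := by
  simp [growthWeight]

theorem growthWeight_nonneg {M : ℝ} (hM : 0 ≤ M) (m : ℕ) : 0 ≤ growthWeight k M m := by
  unfold growthWeight
  positivity

theorem sum_half_pow_le_one (m : ℕ) : ∑ b ∈ Finset.Icc 1 m, (1 / 2 : ℝ) ^ b ≤ 1 := by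
  have h : ∑ b ∈ Finset.Icc 1 m, (1 / 2 : ℝ) ^ b = 1 - (1 / 2) ^ m := by
    induction m with
    | zero => simp
    | succ m ih =>
        rw [Finset.sum_Icc_succ_top (by omega), ih, pow_succ]
        ring
  rw [h]
  have : (0 : ℝ) < (1 / 2) ^ m := by positivity
  linarith

theorem sum_growthWeight_le {x : ℝ} (hx : 0 ≤ x) {a : ℕ} :
    ∑ b ∈ Finset.Icc 1 (min a (k - a)),
      x ^ b * (1 / 2) ^ (a * b) * growthWeight k (2 * x) (a + b) ≤ growthWeight k (2 * x) a := by
  have hterm : ∀ b ∈ Finset.Icc 1 (min a (k - a)),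
      x ^ b * (1 / 2) ^ (a * b) * growthWeight k (2 * x) (a + b) ≤
        (1 / 2) ^ b * growthWeight k (2 * x) a := by
    intro b hb
    rw [Finset.mem_Icc, le_min_iff] at hb
    have hsub : k - a = (k - (a + b)) + b := by omega
    have hpow : (1 / 2 : ℝ) ^ (a * b) = 2 ^ (-((a : ℝ) * b)) := by
      rw [Real.rpow_neg (by norm_num), ← Nat.cast_mul, Real.rpow_natCast, one_div, inv_pow]
    have hexp : (2 : ℝ) ^ (-((a : ℝ) * b)) * 2 ^ (-((k : ℝ) ^ 2 - ((a + b : ℕ) : ℝ) ^ 2) / 3) ≤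
        2 ^ (-((k : ℝ) ^ 2 - (a : ℝ) ^ 2) / 3) := by
      rw [← Real.rpow_add (by norm_num)]
      refine Real.rpow_le_rpow_of_exponent_le (by norm_num) ?_
      have hab : (b : ℝ) ≤ a := by exact_mod_cast hb.2.1
      have hb0 : (0 : ℝ) ≤ b := Nat.cast_nonneg _
      push_cast
      nlinarith [mul_nonneg hb0 (sub_nonneg.2 hab)]
    rw [growthWeight, growthWeight, hpow, hsub, pow_add]
    calc x ^ b * 2 ^ (-((a : ℝ) * b)) * ((2 * x) ^ (k - (a + b)) *
          2 ^ (-((k : ℝ) ^ 2 - ((a + b : ℕ) : ℝ) ^ 2) / 3))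
        = x ^ b * (2 * x) ^ (k - (a + b)) * (2 ^ (-((a : ℝ) * b)) *
          2 ^ (-((k : ℝ) ^ 2 - ((a + b : ℕ) : ℝ) ^ 2) / 3)) := by ring
      _ ≤ x ^ b * (2 * x) ^ (k - (a + b)) * 2 ^ (-((k : ℝ) ^ 2 - (a : ℝ) ^ 2) / 3) := by gcongr
      _ = (1 / 2) ^ b * ((2 * x) ^ (k - (a + b)) * (2 * x) ^ b *
          2 ^ (-((k : ℝ) ^ 2 - (a : ℝ) ^ 2) / 3)) := by
          rw [mul_pow 2 x b, one_div, inv_pow]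
          field_simp
  refine (Finset.sum_le_sum hterm).trans ?_
  rw [← Finset.sum_mul]
  exact mul_le_of_le_one_left (growthWeight_nonneg (by positivity) _) (sum_half_pow_le_one _)

theorem growthWeight_one (hk : 1 ≤ k) {x : ℝ} :
    growthWeight k (2 * x) 1 = (2 * x * (2 : ℝ) ^ (-((k : ℝ) + 1) / 3)) ^ (k - 1) := by
  rw [growthWeight, mul_pow (2 * x), ← Real.rpow_natCast ((2 : ℝ) ^ (-((k : ℝ) + 1) / 3)),
    ← Real.rpow_mul (by norm_num)]
  congr 2
  push_cast [hk]
  ring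

theorem three_le_log (hk : 10 ^ 8 ≤ k) : 3 ≤ Real.log k := by
  have hk' : (10 ^ 8 : ℝ) ≤ k := by exact_mod_cast hk
  rw [Real.le_log_iff_exp_le (by linarith [show (0 : ℝ) < 10 ^ 8 by norm_num])]
  refine le_trans ?_ hk'
  have h3 : Real.exp 3 = Real.exp 1 ^ 3 := by rw [← Real.exp_nat_mul]; norm_num
  rw [h3]
  calc Real.exp 1 ^ 3 ≤ 3 ^ 3 := by
        gcongr
        linarith [Real.exp_one_lt_d9]
    _ ≤ 10 ^ 8 := by norm_num

theorem mul_sq_le_two_rpow (hk : 10 ^ 8 ≤ k) :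
    32 * (k : ℝ) ^ 2 ≤ (2 : ℝ) ^ ((k : ℝ) / Real.log k) := by
  have hk' : (10 ^ 8 : ℝ) ≤ k := by exact_mod_cast hk
  have hk0 : (0 : ℝ) < k := by linarith [show (0 : ℝ) < 10 ^ 8 by norm_num]
  have hL := three_le_log hk
  -- With `s = k ^ (1 / 4)` one has `log k ≤ 4 * s`, so that `k / log k ≥ s ^ 3 / 4`.
  set s := (k : ℝ) ^ (1 / 4 : ℝ) with hs
  have hs4 : s ^ 4 = k := by
    rw [hs, ← Real.rpow_natCast, ← Real.rpow_mul hk0.le]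
    norm_num
  have hs0 : 0 ≤ s := by positivity
  have hs100 : 100 ≤ s := by
    by_contra hlt
    push Not at hlt
    have : s ^ 4 < 100 ^ 4 := pow_lt_pow_left₀ hlt hs0 (by norm_num)
    rw [hs4] at this
    norm_num at this hk'
    linarith
  have hLs : Real.log k ≤ 4 * s := by
    have := Real.log_le_rpow_div hk0.le (show (0 : ℝ) < 1 / 4 by norm_num)
    rw [← hs] at this
    linarith
  have hq : s ^ 3 / 4 ≤ k / Real.log k := by
    rw [le_div_iff₀ (by linarith)]
    calc s ^ 3 / 4 * Real.log k ≤ s ^ 3 / 4 * (4 * s) := by gcongr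
      _ = (k : ℝ) := by rw [← hs4]; ring
  rw [Real.rpow_def_of_pos (by norm_num), ← Real.log_le_iff_le_exp (by positivity),
    Real.log_mul (by norm_num) (by positivity), Real.log_pow,
    show (32 : ℝ) = 2 ^ 5 by norm_num, Real.log_pow]
  have h₁ := Real.log_two_gt_d9
  have h₂ := Real.log_two_lt_d9
  have h₃ : (1 / 2) * (s ^ 3 / 4) ≤ Real.log 2 * (k / Real.log k) :=
    mul_le_mul (by linarith) hq (by positivity) (by linarith)
  push_cast
  have h₄ : 100 ^ 2 * s ≤ s ^ 3 := by nlinarith [mul_le_mul hs100 hs100 (by norm_num) hs0]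
  linarith

theorem growthWeight_one_le (hk : 10 ^ 8 ≤ k) {D : ℝ} (hD0 : 0 ≤ D)
    (hD : D ≤ 8 * (2 : ℝ) ^ ((k : ℝ) / 3 - k / Real.log k) * k) :
    growthWeight k (2 * (k * D)) 1 ≤ 1 / (2 * k) := by
  have hk0 : (0 : ℝ) < k := by
    have : 0 < k := by omega
    exact_mod_cast this
  have hbase : 2 * (k * D) * (2 : ℝ) ^ (-((k : ℝ) + 1) / 3) ≤ 1 / 2 := by
    calc 2 * (k * D) * (2 : ℝ) ^ (-((k : ℝ) + 1) / 3)
        ≤ 2 * (k * (8 * (2 : ℝ) ^ ((k : ℝ) / 3 - k / Real.log k) * k)) *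
          (2 : ℝ) ^ (-(k : ℝ) / 3) := by
          gcongr
          · norm_num
          · linarith
      _ = 16 * k ^ 2 * ((2 : ℝ) ^ ((k : ℝ) / 3 - k / Real.log k) * (2 : ℝ) ^ (-(k : ℝ) / 3)) := by
          ring
      _ = 16 * k ^ 2 * ((2 : ℝ) ^ ((k : ℝ) / Real.log k))⁻¹ := by
          rw [← Real.rpow_add (by norm_num), ← Real.rpow_neg (by norm_num)]
          congr 2
          ring
      _ ≤ 1 / 2 := by
          rw [← div_eq_mul_inv, div_le_iff₀ (by positivity)]
          linarith [mul_sq_le_two_rpow hk]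
  rw [growthWeight_one (by omega)]
  refine (pow_le_pow_left₀ (by positivity) hbase _).trans ?_
  rw [one_div, one_div, inv_pow]
  refine inv_anti₀ (by positivity) ?_
  obtain ⟨m, rfl⟩ := Nat.exists_eq_add_of_le' (show 3 ≤ k by omega)
  have hm : 2 * (m + 3) ≤ 2 ^ (m + 3 - 1) := by
    obtain ⟨l, rfl⟩ := Nat.exists_eq_add_of_le' (show 1 ≤ m by omega)
    have : l + 1 ≤ 2 ^ l := Nat.lt_two_pow_self
    rw [show l + 1 + 3 - 1 = l + 3 by omega, pow_add]
    omega
  exact_mod_cast hm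

/-- The lower bound for large `k`. -/
theorem ForcesWithin.rpow_mul_le (hk : 10 ^ 8 ≤ k) {t : ℕ}
    (h : ForcesWithin (board n) 1 (cliqueFactors n k) t ∅ ∅) :
    (2 : ℝ) ^ ((k : ℝ) / 3 - k / Real.log k) * n ≤ t := by
  have hk1 : 1 ≤ k := by omega
  have hk0 : (1 : ℝ) ≤ k := by exact_mod_cast hk1
  have hL := three_le_log hk
  set d := (2 : ℝ) ^ ((k : ℝ) / 3 - k / Real.log k) with hd
  have hd1 : 1 ≤ d := by
    refine Real.one_le_rpow (by norm_num) (sub_nonneg.2 ?_)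
    gcongr
  -- Client ignores cliques with a vertex at which more than `8 * d * k` edges are claimed.
  set D := ⌊8 * d * k⌋₊ with hDdef
  have hdk : 1 ≤ 8 * d * k := by nlinarith
  have hD : 0 < D := Nat.floor_pos.2 hdk
  have hDle : (D : ℝ) ≤ 8 * d * k := Nat.floor_le (by linarith)
  have hDlt : 8 * d * k < D + 1 := Nat.lt_floor_add_one _
  have hmain := h.le_potential (D := D) (γ := growthWeight k (2 * (k * D))) hk1
    (fun a => growthWeight_nonneg (by positivity) a) (growthWeight_self _ _) hD
    (fun a _ _ => sum_growthWeight_le (by positivity))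
  have hγ := growthWeight_one_le hk (Nat.cast_nonneg D) hDle
  have h₁ : (n : ℝ) * growthWeight k (2 * (k * D)) 1 ≤ n * (1 / (2 * k)) := by gcongr
  have h₂ : 4 * (t : ℝ) / (D + 1) ≤ 4 * t / (8 * d * k) := by gcongr
  have h₃ : (n : ℝ) / k ≤ n * (1 / (2 * k)) + 4 * t / (8 * d * k) := by linarith
  have h₄ : (n : ℝ) / k = 2 * (n * (1 / (2 * k))) := by field_simp
  have h₅ : (n : ℝ) * (1 / (2 * k)) = d * n * (1 / (2 * d * k)) := by field_simp
  have h₆ : 4 * (t : ℝ) / (8 * d * k) = t * (1 / (2 * d * k)) := by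
    field_simp
    ring
  rw [h₄, h₅, h₆] at h₃
  have h₇ : 0 < 1 / (2 * d * k) := by positivity
  exact le_of_mul_le_mul_right (by linarith) h₇

end LowerBound

theorem isLittleO_div_log :
    (fun k : ℕ => (k : ℝ) / Real.log k) =o[Filter.atTop] fun k : ℕ => (k : ℝ) := by
  have h : (fun k : ℕ => (Real.log k)⁻¹) =o[Filter.atTop] fun _ : ℕ => (1 : ℝ) :=
    (Asymptotics.isLittleO_one_iff ℝ).2
      (Real.tendsto_log_atTop.comp tendsto_natCast_atTop_atTop).inv_tendsto_atTop
  simpa [div_eq_mul_inv] using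
    (Asymptotics.isBigO_refl (fun k : ℕ => (k : ℝ)) Filter.atTop).mul_isLittleO h

end WaiterClient

theorem theorem2 :
    ∃ (n₀ : ℕ → ℕ) (C : ℕ → ℝ) (f : ℕ → ℝ),
      (f =o[Filter.atTop] (fun k : ℕ => (k : ℝ))) ∧
      (∀ k : ℕ, 10 ^ 8 ≤ k → f k = (k : ℝ) / Real.log (k : ℝ)) ∧
      (∀ k : ℕ, 4 ≤ k → C k = (2 : ℝ) ^ (8 ^ k) + (2 : ℝ) ^ k * (k : ℝ)) ∧
      ∀ k : ℕ, 2 ≤ k → ∀ n : ℕ, n₀ k ≤ n → k ∣ n →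
        WaiterClient.WaiterWins (WaiterClient.board n) 1 (WaiterClient.cliqueFactors n k) ∧
        (2 : ℝ) ^ ((k : ℝ) / 3 - f k) * (n : ℝ) ≤
          (WaiterClient.tau (WaiterClient.board n) 1 (WaiterClient.cliqueFactors n k) : ℝ) ∧
        (WaiterClient.tau (WaiterClient.board n) 1 (WaiterClient.cliqueFactors n k) : ℝ) ≤
          (2 : ℝ) ^ k * ((n : ℝ) / (k : ℝ)) + C k := by
  -- For `k < 10 ^ 8` the choice of `f` makes the lower bound `n / 2`.
  refine ⟨fun k => (2 ^ 8 ^ k + 2 ^ k + k) * 2 ^ k, fun k => 2 ^ (8 ^ k) + 2 ^ k * k,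
    fun k => if 10 ^ 8 ≤ k then (k : ℝ) / Real.log k else k / 3 + 1, ?_, ?_, fun _ _ => rfl, ?_⟩
  · refine WaiterClient.isLittleO_div_log.congr' ?_ Filter.EventuallyEq.rfl
    filter_upwards [Filter.eventually_ge_atTop (10 ^ 8)] with k hk
    rw [if_pos hk]
  · intro k hk
    exact if_pos hk
  intro k hk n hn hkn
  have hforce : WaiterClient.ForcesWithin (WaiterClient.board n) 1
      (WaiterClient.cliqueFactors n k) (n / k * 2 ^ k + 2 ^ 8 ^ k) ∅ ∅ :=
    ((WaiterClient.reach_tiling (by omega) hkn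
      (WaiterClient.absorption_cost_le (by omega)) rfl hn).mono
      fun _ _ h => h.exists_cliqueFactor (by omega)).forcesWithin
  have htau : WaiterClient.ForcesWithin (WaiterClient.board n) 1 (WaiterClient.cliqueFactors n k)
      (WaiterClient.tau (WaiterClient.board n) 1 (WaiterClient.cliqueFactors n k)) ∅ ∅ :=
    Nat.sInf_mem (s := {t | WaiterClient.ForcesWithin (WaiterClient.board n) 1
      (WaiterClient.cliqueFactors n k) t ∅ ∅}) ⟨_, hforce⟩
  refine ⟨⟨_, hforce⟩, ?_, ?_⟩
  · by_cases hk8 : 10 ^ 8 ≤ k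
    · simp only [if_pos hk8]
      exact htau.rpow_mul_le hk8
    · simp only [if_neg hk8]
      have h : (n : ℝ) ≤ 2 * WaiterClient.tau (WaiterClient.board n) 1
          (WaiterClient.cliqueFactors n k) := by exact_mod_cast htau.le_two_mul hk
      rw [show (k : ℝ) / 3 - (k / 3 + 1) = -1 by ring, Real.rpow_neg_one]
      linarith
  · have hle : WaiterClient.tau (WaiterClient.board n) 1 (WaiterClient.cliqueFactors n k) ≤
        n / k * 2 ^ k + 2 ^ 8 ^ k := Nat.sInf_le hforce
    have hle' : (WaiterClient.tau (WaiterClient.board n) 1 (WaiterClient.cliqueFactors n k) : ℝ) ≤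
        (n / k : ℕ) * 2 ^ k + 2 ^ 8 ^ k := by exact_mod_cast hle
    have hdiv : ((n / k : ℕ) : ℝ) * 2 ^ k ≤ 2 ^ k * ((n : ℝ) / k) := by
      rw [mul_comm]
      gcongr
      exact Nat.cast_div_le
    have hpos : (0 : ℝ) ≤ 2 ^ k * k := by positivity
    linarith
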